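/- Let $\mathfrak A$ be a nonzero (complex, not necessarily unital or separable) C*-algebra and let $\mathfrak{uA}$ be the smallest unital C*-algebra containing $\mathfrak A$: $\mathfrak{uA}=\mathfrak A$ if $\mathfrak A$ is unital, and $\mathfrak{uA}=\mathfrak A\oplus\mathbb C1$ is the standard unitization otherwise. Let $\mathscr S(\mathfrak A)$ be the set of states of $\mathfrak A$ (positive linear functionals of norm one); a state is identified with its unique extension to $\mathfrak{uA}$ with value $1$ at the unit, and with the corresponding normal state of the enveloping von Neumann algebra $\mathfrak A^{**}$. *Lipschitz triples.* A Lipschitz triple $(\mathfrak A,\mathsf L,\mathfrak M)$ consists of $\mathfrak A$, a seminorm $\mathsf L$ defined on a dense real subspace of the self-adjoint part of $\mathfrak{uA}$ with $\{a:\mathsf L(a)=0\}=\mathbb R1$, and an abelian C*-subalgebra $\mathfrak M\subseteq\mathfrak A$ that contains an approximate identity of $\mathfrak A$. Let $\sigma(\mathfrak M)$ be the Gelfand spectrum of $\mathfrak M$, so $\mathfrak M\cong C_0(\sigma(\mathfrak M))$. For compact $K\subseteq\sigma(\mathfrak M)$, let $1_K\in\mathfrak M^{**}\subseteq\mathfrak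 A^{**}$ be the indicator function of $K$ and $$\mathscr S(\mathfrak A|K)=\{\varphi\in\mathscr S(\mathfrak A):\varphi(1_K)=1\}.$$ The elements of $\mathscr S(\mathfrak A|\mathfrak M)=\bigcup_K\mathscr S(\mathfrak A|K)$ are the local states. For a state $\mu$, put $$\mathfrak L_1(\mathfrak A,\mathsf L,\mu)=\{a\in\mathfrak{uA}: a=a^*,\ \mathsf L(a)\le1,\ \mu(a)=0\},$$ where $\mathsf L(a)\le 1$ includes that $a$ is in the domain of $\mathsf L$, and for states $\varphi,\psi$ of $\mathfrak A$ let $$\mathrm{mk}_{\mathsf L}(\varphi,\psi)=\sup\{|\varphi(a)-\psi(a)|: a=a^*\in\mathfrak A,\ \mathsf L(a)\le1\}\in[0,\infty].$$ *Quantum locally compact metric spaces.* The triple is regular if $\mathscr S(\mathfrak A|K)$ has finite $\mathrm{mk}_{\mathsf L}$-diameter for every compact $K\subseteq\sigma(\mathfrak M)$. A set $\mathscr K$ of states is tame if for some local state $\mu$ $$\lim_{K}\ \sup\{|\varphi(a-1_Ka1_K)|: a\in\mathfrak L_1(\mathfrak A,\mathsf L,\mu),\ \varphi\in\mathscr K\}=0,$$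 the limit being over the compact subsets $K$ of $\sigma(\mathfrak M)$ directed by inclusion. The triple is a quantum locally compact metric space if it is regular and, for every tame set $\mathscr K$ of states, the topology induced on $\mathscr K$ by $\mathrm{mk}_{\mathsf L}$ is the relative weak* topology $\sigma(\mathfrak A^*,\mathfrak A)$. **Theorem.** For every Lipschitz triple $(\mathfrak A,\mathsf L,\mathfrak M)$ with $\mathfrak A\ne0$, the following are equivalent: 1. $(\mathfrak A,\mathsf L,\mathfrak M)$ is a quantum locally compact metric space; 2. for all local states $\mu\in\mathscr S(\mathfrak A|\mathfrak M)$ and all compactly supported $a,b\in\mathfrak M$, the set $a\,\mathfrak L_1(\mathfrak A,\mathsf L,\mu)\,b$ is totally bounded in the norm of $\mathfrak{uA}$; 3. for some local state $\mu\in\mathscr S(\mathfrak A|\mathfrak M)$ and all compactly supported $a,b\in\mathfrak M$, the set $a\,\mathfrak L_1(\mathfrak A,\mathsf L,\mu)\,b$ is totally bounded in the norm of $\mathfrak{uA}$. -/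

import Mathlib

noncomputable section
namespace QLCMS

open Filter Topology WeakDual TopologicalSpace
open scoped ENNReal ComplexOrder

universe u

/-! ### The smallest unital C*-algebra containing a C*-algebra -/


/-- `A` has a multiplicative unit. -/
def HasUnit (A : Type u) [NonUnitalCStarAlgebra A] : Prop :=
  ∃ e : A, ∀ a : A, e * a = a ∧ a * e = a

/-- A C*-algebra possessing a unit, regarded as a unital C*-algebra: all operations and the norm
are those of `A`, only the unit is named. -/
@[reducible] def cstarAlgebraOfUnit (A : Type u) [inst : NonUnitalCStarAlgebra A] (h : HasUnit A) :
    CStarAlgebra A :=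
  letI : NormedRing A :=
    { inst.toNonUnitalNormedRing with
      one := h.choose
      one_mul := fun a => (h.choose_spec a).1
      mul_one := fun a => (h.choose_spec a).2 }
  letI : NormedAlgebra ℂ A :=
    { Algebra.ofModule (fun r x y => smul_mul_assoc r x y) (fun r x y => mul_smul_comm r x y) with
      norm_smul_le := fun r x => norm_smul_le r x }
  { toStarRing := inst.toStarRing
    toCStarRing := inst.toCStarRing
    toCompleteSpace := inst.toCompleteSpace
    toStarModule := inst.toStarModule }

/-- A unital C*-algebra together with a *-homomorphism from `A` into it. -/
structure UnitalExtension (A : Type u) [NonUnitalCStarAlgebra A] where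
  carrier : Type u
  [inst : CStarAlgebra carrier]
  emb : A →⋆ₙₐ[ℂ] carrier

attribute [instance] UnitalExtension.inst

open Classical in
/-- `A` itself (with the identity map) if `A` is unital, and otherwise the standard unitization
`A ⊕ ℂ` with its C*-norm (with the canonical inclusion). -/
def minimalUnitization (A : Type u) [inst : NonUnitalCStarAlgebra A] : UnitalExtension A :=
  if h : HasUnit A then
    @UnitalExtension.mk A _ A (cstarAlgebraOfUnit A h)
      (@NonUnitalStarAlgHom.id ℂ A _
        inst.toNonUnitalNormedRing.toNonUnitalRing.toNonUnitalNonAssocRing.toNonUnitalNonAssocSemiring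
        _ _)
  else
    { carrier := Unitization ℂ A
      emb := Unitization.inrNonUnitalStarAlgHom ℂ A }

/-- The smallest unital C*-algebra `𝔲A` containing `A`: it is `A` if `A` is unital and `A ⊕ ℂ`
otherwise. -/
def UnitalHull (A : Type u) [NonUnitalCStarAlgebra A] : Type u := (minimalUnitization A).carrier

instance (A : Type u) [NonUnitalCStarAlgebra A] : CStarAlgebra (UnitalHull A) :=
  (minimalUnitization A).inst

/-- The inclusion of `A` in `𝔲A`. -/
def UnitalHull.emb (A : Type u) [NonUnitalCStarAlgebra A] : A →⋆ₙₐ[ℂ] UnitalHull A :=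
  (minimalUnitization A).emb

/-- The states of `A`: the positive linear functionals of norm one. -/
def State (A : Type u) [NonUnitalCStarAlgebra A] : Type u :=
  {φ : WeakDual ℂ A // (∀ a : A, 0 ≤ φ (star a * a)) ∧ ‖WeakDual.toStrongDual φ‖ = 1}

/-- The state space carries the relative weak* topology `σ(A*, A)`. -/
instance (A : Type u) [NonUnitalCStarAlgebra A] : TopologicalSpace (State A) :=
  inferInstanceAs (TopologicalSpace {φ : WeakDual ℂ A //
    (∀ a : A, 0 ≤ φ (star a * a)) ∧ ‖WeakDual.toStrongDual φ‖ = 1})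

variable {A : Type u} [NonUnitalCStarAlgebra A]

/-- A state as an element of the normed dual of `A`. -/
def State.toDual (φ : State A) : StrongDual ℂ A := WeakDual.toStrongDual φ.1

theorem State.nonneg (φ : State A) (a : A) : 0 ≤ φ.toDual (star a * a) := φ.2.1 a
theorem State.norm_toDual (φ : State A) : ‖φ.toDual‖ = 1 := φ.2.2

theorem State.cauchySchwarz (φ : State A) (a b : A) :
    ‖φ.toDual (star a * b)‖ ≤
      √(φ.toDual (star a * a)).re * √(φ.toDual (star b * b)).re := by
  let _ := CStarAlgebra.spectralOrder A
  have := CStarAlgebra.spectralOrderedRing A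
  let f : A →ₚ[ℂ] ℂ := PositiveLinearMap.mk₀ (φ.toDual : A →ₗ[ℂ] ℂ) (by
    intro x hx
    obtain ⟨y, rfl⟩ := CStarAlgebra.nonneg_iff_eq_star_mul_self.mp hx
    exact φ.nonneg y)
  exact norm_inner_le_norm (𝕜 := ℂ) (f.toPreGNS a) (f.toPreGNS b)

theorem State.apply_unit (φ : State A) {e : A} (he : ∀ a : A, e * a = a ∧ a * e = a) :
    φ.toDual e = 1 := by
  have hs : star e = e := by
    have h1 : star e * e = star e := (he _).2
    have h2 := congrArg star h1
    rw [star_mul, star_star] at h2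
    exact h1.symm.trans h2
  have hee : star e * e = e := by rw [hs]; exact (he e).1
  have hpos : 0 ≤ φ.toDual e := hee ▸ φ.nonneg e
  have hen : ‖e‖ ≤ 1 := by
    have := CStarRing.norm_star_mul_self (x := e)
    rw [hee] at this
    nlinarith [norm_nonneg e]
  set t := (φ.toDual e).re with ht
  have ht0 : 0 ≤ t := (Complex.nonneg_iff.mp hpos).1
  have het : φ.toDual e = (t : ℂ) :=
    Complex.ext rfl (by simpa using (Complex.nonneg_iff.mp hpos).2.symm)
  have ht1 : t ≤ 1 := by
    have := φ.toDual.le_opNorm e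
    rw [φ.norm_toDual, het, Complex.norm_real, Real.norm_of_nonneg ht0] at this
    linarith
  have hbound : ‖φ.toDual‖ ≤ √t := by
    refine ContinuousLinearMap.opNorm_le_bound _ (Real.sqrt_nonneg _) fun a => ?_
    have h := φ.cauchySchwarz e a
    rw [hs, (he a).1, (he e).1] at h
    refine h.trans (mul_le_mul_of_nonneg_left ?_ (Real.sqrt_nonneg _))
    refine Real.sqrt_le_iff.mpr ⟨norm_nonneg _, ?_⟩
    calc (φ.toDual (star a * a)).re ≤ ‖φ.toDual (star a * a)‖ := Complex.re_le_norm _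
      _ ≤ ‖φ.toDual‖ * ‖star a * a‖ := φ.toDual.le_opNorm _
      _ = ‖a‖ ^ 2 := by rw [φ.norm_toDual, one_mul, CStarRing.norm_star_mul_self, sq]
  rw [φ.norm_toDual] at hbound
  have : 1 ≤ t := by
    by_contra hlt
    have := Real.sqrt_lt_sqrt ht0 (not_le.mp hlt)
    rw [Real.sqrt_one] at this
    linarith
  rw [het, le_antisymm ht1 this, Complex.ofReal_one]

theorem UnitalHull.norm_emb (a : A) : ‖UnitalHull.emb A a‖ = ‖a‖ := by
  suffices H : ∀ U, U = minimalUnitization A → ∀ a : A, ‖U.emb a‖ = ‖a‖ from H _ rfl a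
  rintro U hU a
  unfold minimalUnitization at hU
  split_ifs at hU with h
  · subst hU; rfl
  · subst hU; exact Unitization.norm_inr (𝕜 := ℂ) a

theorem exists_eq_unitization (x : Unitization ℂ A) :
    ∃ (a : A) (r : ℂ), x = Unitization.inrNonUnitalStarAlgHom ℂ A a + r • 1 :=
  ⟨x.snd, x.fst, by ext <;> simp⟩

theorem exists_extension_unitization (f : StrongDual ℂ A) :
    ∃ g : StrongDual ℂ (Unitization ℂ A),
      g 1 = 1 ∧ ∀ a, g (Unitization.inrNonUnitalStarAlgHom ℂ A a) = f a :=
  ⟨{ toFun := fun x => x.fst + f x.snd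
     map_add' := fun x y => by simp; ring
     map_smul' := fun r x => by simp; ring
     cont := Unitization.continuous_fst.add (f.continuous.comp Unitization.continuous_snd) },
   by simp, fun a => by simp⟩

theorem UnitalHull.exists_eq (x : UnitalHull A) :
    ∃ (a : A) (r : ℂ), x = UnitalHull.emb A a + r • 1 := by
  suffices H : ∀ U, U = minimalUnitization A → ∀ x : U.carrier,
      ∃ (a : A) (r : ℂ), x = U.emb a + r • 1 from H _ rfl x
  rintro U hU x
  unfold minimalUnitization at hU
  split_ifs at hU with h
  · subst hU
    let _ := cstarAlgebraOfUnit A h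
    refine ⟨x, 0, ?_⟩
    rw [zero_smul, add_zero]
    rfl
  · subst hU
    exact exists_eq_unitization x

theorem UnitalHull.surjective_emb (h : HasUnit A) : Function.Surjective (UnitalHull.emb A) := by
  suffices H : ∀ U, U = minimalUnitization A → Function.Surjective U.emb from H _ rfl
  rintro U hU
  unfold minimalUnitization at hU
  rw [dif_pos h] at hU
  subst hU
  exact fun x => ⟨x, rfl⟩

theorem State.exists_extension (φ : State A) :
    ∃ ψ : StrongDual ℂ (UnitalHull A), ψ 1 = 1 ∧ ∀ a, ψ (UnitalHull.emb A a) = φ.toDual a := by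
  suffices H : ∀ U, U = minimalUnitization A →
      ∃ ψ : StrongDual ℂ U.carrier, ψ 1 = 1 ∧ ∀ a, ψ (U.emb a) = φ.toDual a from H _ rfl
  rintro U hU
  unfold minimalUnitization at hU
  split_ifs at hU with h
  · subst hU
    exact ⟨φ.toDual, φ.apply_unit h.choose_spec, fun a => rfl⟩
  · subst hU
    exact exists_extension_unitization φ.toDual

/-- A state `φ` of `A` has exactly one extension to a continuous linear functional on `𝔲A` that
takes the value `1` at the unit. -/
theorem State.exists_unique_extension (φ : State A) :
    ∃! ψ : StrongDual ℂ (UnitalHull A), ψ 1 = 1 ∧ ∀ a, ψ (UnitalHull.emb A a) = φ.toDual a := by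
  obtain ⟨ψ, hψ⟩ := φ.exists_extension
  refine ⟨ψ, hψ, fun ρ hρ => ContinuousLinearMap.ext fun x => ?_⟩
  obtain ⟨a, r, rfl⟩ := UnitalHull.exists_eq x
  simp [hψ.1, hψ.2, hρ.1, hρ.2]

/-- The extension of a state of `A` to `𝔲A`. -/
def State.ext (φ : State A) : StrongDual ℂ (UnitalHull A) := φ.exists_unique_extension.choose

theorem State.ext_one (φ : State A) : φ.ext 1 = 1 := φ.exists_unique_extension.choose_spec.1.1

theorem State.ext_emb (φ : State A) (a : A) : φ.ext (UnitalHull.emb A a) = φ.toDual a :=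
  φ.exists_unique_extension.choose_spec.1.2 a

/-! ### Indicator functions of compact sets in the bidual of an abelian C*-algebra

Let `M` be an abelian C*-algebra with spectrum `σ(M)`, so that `M ≅ C₀(σ(M))`, and `K ⊆ σ(M)`
compact. The functions `f ∈ M` with `0 ≤ f ≤ 1` and `f = 1` on `K` form a net that decreases
pointwise to the indicator function of `K`. For `ω ∈ M*`, represented by a (complex) Radon
measure, `ω(f)` tends to the measure of `K`; this is the value at `ω` of the indicator function
as an element of `M**`. -/

section
variable {M : Type u} [NonUnitalCommCStarAlgebra M]

/-- The functions `f ∈ M ≅ C₀(σ(M))` with `0 ≤ f ≤ 1` and `f = 1` on `K`. -/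
def urysohn (K : Set (characterSpace ℂ M)) : Set M :=
  {f | ∀ χ : characterSpace ℂ M, (∃ t ∈ Set.Icc (0 : ℝ) 1, χ f = t) ∧ (χ ∈ K → χ f = 1)}

/-- The filter of the net `urysohn K`, directed downwards by the pointwise order. -/
def urysohnFilter (K : Set (characterSpace ℂ M)) : Filter M :=
  ⨅ g ∈ urysohn K, 𝓟 {f ∈ urysohn K | ∀ χ : characterSpace ℂ M, (χ f).re ≤ (χ g).re}

/-- The extension of a character of `M` to the unitization. -/
def liftChar (χ : characterSpace ℂ M) : characterSpace ℂ (Unitization ℂ M) :=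
  CharacterSpace.equivAlgHom.symm (Unitization.lift (CharacterSpace.toNonUnitalAlgHom χ))

theorem liftChar_apply (χ : characterSpace ℂ M) (x : Unitization ℂ M) :
    liftChar χ x = x.fst + χ x.snd := by
  simp [liftChar, Unitization.lift]

theorem continuous_liftChar : Continuous (liftChar (M := M)) := by
  refine Continuous.subtype_mk (WeakDual.continuous_of_continuous_eval fun x => ?_) _
  have : Continuous fun χ : characterSpace ℂ M => x.fst + χ x.snd :=
    continuous_const.add ((WeakDual.eval_continuous x.snd).comp continuous_subtype_val)
  exact this.congr fun χ => (liftChar_apply χ x).symm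

theorem norm_le_of_char {x : M} {C : ℝ} (hC : 0 ≤ C)
    (h : ∀ χ : characterSpace ℂ M, ‖χ x‖ ≤ C) : ‖x‖ ≤ C := by
  rw [← Unitization.norm_inr (𝕜 := ℂ) x,
    ← (gelfandTransform_isometry (Unitization ℂ M)).norm_map_of_map_zero (map_zero _)]
  refine (ContinuousMap.norm_le _ hC).mpr fun ψ => ?_
  change ‖ψ (Unitization.inr x)‖ ≤ C
  let φ : WeakDual ℂ M := StrongDual.toWeakDual
    { toFun := fun y => ψ (Unitization.inr y : Unitization ℂ M)
      map_add' := fun y z => by rw [Unitization.inr_add, map_add]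
      map_smul' := fun r y => by rw [Unitization.inr_smul, map_smul]; rfl
      cont := (map_continuous ψ).comp Unitization.continuous_inr }
  have hφ (y : M) : φ y = ψ (Unitization.inr y) := rfl
  by_cases h0 : φ = 0
  · rw [← hφ, h0]; change ‖(0 : ℂ)‖ ≤ C; simpa using hC
  · exact h ⟨φ, h0, fun a b => by rw [hφ, hφ, hφ, Unitization.inr_mul, map_mul]⟩

theorem urysohn_nonempty {K : Set (characterSpace ℂ M)} (hK : IsCompact K) :
    (urysohn K).Nonempty := by
  let pinf : characterSpace ℂ (Unitization ℂ M) :=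
    CharacterSpace.equivAlgHom.symm (Unitization.fstHom ℂ M)
  have hinf (x : Unitization ℂ M) : pinf x = x.fst := rfl
  have hd : Disjoint {pinf} (liftChar '' K) := by
    rw [Set.disjoint_singleton_left]
    rintro ⟨χ, -, hχ⟩
    refine χ.2.1 (ContinuousLinearMap.ext fun a => ?_)
    have := congrArg (fun ψ : characterSpace ℂ (Unitization ℂ M) => ψ (Unitization.inr a)) hχ
    simpa [liftChar_apply, hinf] using! this
  obtain ⟨f, hf0, hf1, hf⟩ := exists_continuous_zero_one_of_isClosed isClosed_singleton
    (hK.image continuous_liftChar).isClosed hd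
  let g : C(characterSpace ℂ (Unitization ℂ M), ℂ) := ⟨fun ψ => (f ψ : ℂ), by fun_prop⟩
  obtain ⟨y, hy⟩ := (gelfandTransform_bijective (Unitization ℂ M)).2 g
  have hy' (ψ : characterSpace ℂ (Unitization ℂ M)) : ψ y = f ψ := congrArg (· ψ) hy
  have hfst : y.fst = 0 := by
    rw [← hinf, hy', hf0 rfl]; simp
  have hval (χ : characterSpace ℂ M) : χ y.snd = f (liftChar χ) := by
    rw [← hy', liftChar_apply, hfst, zero_add]
  refine ⟨y.snd, fun χ => ⟨⟨_, hf _, hval χ⟩, fun hχ => ?_⟩⟩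
  rw [hval, hf1 ⟨χ, hχ, rfl⟩]; simp

theorem urysohn_mul {K : Set (characterSpace ℂ M)} {f g : M} (hf : f ∈ urysohn K)
    (hg : g ∈ urysohn K) : f * g ∈ urysohn K ∧
      ∀ χ : characterSpace ℂ M, (χ (f * g)).re ≤ (χ f).re ∧ (χ (f * g)).re ≤ (χ g).re := by
  refine ⟨fun χ => ?_, fun χ => ?_⟩
  · obtain ⟨⟨s, hs, hs'⟩, h1⟩ := hf χ
    obtain ⟨⟨t, ht, ht'⟩, h2⟩ := hg χ
    refine ⟨⟨s * t, ⟨mul_nonneg hs.1 ht.1, mul_le_one₀ hs.2 ht.1 ht.2⟩, ?_⟩, fun h => ?_⟩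
    · rw [map_mul, hs', ht']; simp
    · rw [map_mul, h1 h, h2 h, one_mul]
  · obtain ⟨⟨s, hs, hs'⟩, -⟩ := hf χ
    obtain ⟨⟨t, ht, ht'⟩, -⟩ := hg χ
    rw [map_mul, hs', ht', ← Complex.ofReal_mul]
    simp only [Complex.ofReal_re]
    exact ⟨mul_le_of_le_one_right hs.1 ht.2, mul_le_of_le_one_left ht.1 hs.2⟩

theorem urysohnFilter_hasBasis {K : Set (characterSpace ℂ M)} (hK : IsCompact K) :
    (urysohnFilter K).HasBasis (fun g => g ∈ urysohn K)
      (fun g => {f ∈ urysohn K | ∀ χ : characterSpace ℂ M, (χ f).re ≤ (χ g).re}) := by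
  refine hasBasis_biInf_principal ?_ (urysohn_nonempty hK)
  intro f hf g hg
  obtain ⟨h1, h2⟩ := urysohn_mul hf hg
  exact ⟨f * g, h1, fun x hx => ⟨hx.1, fun χ => (hx.2 χ).trans (h2 χ).1⟩,
    fun x hx => ⟨hx.1, fun χ => (hx.2 χ).trans (h2 χ).2⟩⟩

theorem urysohnFilter_neBot {K : Set (characterSpace ℂ M)} (hK : IsCompact K) :
    (urysohnFilter K).NeBot :=
  (urysohnFilter_hasBasis hK).neBot_iff.mpr fun {g} hg => ⟨g, hg, fun _ => le_rfl⟩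

theorem norm_le_one_of_urysohn {K : Set (characterSpace ℂ M)} {f : M} (hf : f ∈ urysohn K) :
    ‖f‖ ≤ 1 := by
  refine norm_le_of_char zero_le_one fun χ => ?_
  obtain ⟨⟨t, ht, h⟩, -⟩ := hf χ
  rw [h, Complex.norm_real, Real.norm_of_nonneg ht.1]
  exact ht.2

/-- Every continuous linear functional converges along the decreasing net `urysohn K`. -/
theorem cauchy_urysohn {K : Set (characterSpace ℂ M)} (hK : IsCompact K) (ω : StrongDual ℂ M) :
    Cauchy ((urysohnFilter K).map ω) := by
  have hne := urysohnFilter_neBot hK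
  refine Metric.cauchy_iff.mpr ⟨inferInstance, fun ε hε => ?_⟩
  by_contra hcon
  -- arbitrarily far down the net there are pairs with a gap of at least `ε / 2`
  have step : ∀ g ∈ urysohn K, ∃ f ∈ urysohn K, ∃ h ∈ urysohn K,
      (∀ χ : characterSpace ℂ M, (χ h).re ≤ (χ f).re ∧ (χ f).re ≤ (χ g).re) ∧
      ε / 2 ≤ ‖ω (f - h)‖ := by
    intro g hg
    by_contra hno
    push Not at hno
    refine hcon ⟨_, image_mem_map ((urysohnFilter_hasBasis hK).mem_of_mem hg), ?_⟩
    rintro _ ⟨f, hf, rfl⟩ _ ⟨f', hf', rfl⟩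
    obtain ⟨h1, h2⟩ := urysohn_mul hf.1 hf'.1
    have a1 := hno f hf.1 _ h1 fun χ => ⟨(h2 χ).1, hf.2 χ⟩
    have a2 := hno f' hf'.1 _ h1 fun χ => ⟨(h2 χ).2, hf'.2 χ⟩
    rw [dist_eq_norm]
    have : ω f - ω f' = ω (f - f * f') - ω (f' - f * f') := by simp
    rw [this]
    linarith [norm_sub_le (ω (f - f * f')) (ω (f' - f * f'))]
  obtain ⟨g, hg⟩ := urysohn_nonempty hK
  have main : ∀ n : ℕ, ∃ h ∈ urysohn K, ∃ x : M,
      (∀ χ : characterSpace ℂ M, ‖χ x‖ ≤ (χ g).re - (χ h).re) ∧ n * (ε / 2) ≤ (ω x).re := by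
    intro n
    induction n with
    | zero => exact ⟨g, hg, 0, fun χ => by simp, by simp⟩
    | succ n ih =>
      obtain ⟨h, hh, x, hx, hωx⟩ := ih
      obtain ⟨f, hf, h', hh', hle, hgap⟩ := step h hh
      obtain ⟨θ, hθ, hθω⟩ : ∃ θ : ℂ, ‖θ‖ = 1 ∧ θ * ω (f - h') = ‖ω (f - h')‖ := by
        obtain ⟨θ, h1, h2⟩ := RCLike.exists_norm_eq_mul_self (K := ℂ) (ω (f - h'))
        exact ⟨θ, h1, h2.symm⟩
      refine ⟨h', hh', x + θ • (f - h'), fun χ => ?_, ?_⟩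
      · have hd : ‖χ (f - h')‖ = (χ f).re - (χ h').re := by
          obtain ⟨⟨s, hs, hs'⟩, -⟩ := hf χ
          obtain ⟨⟨t, ht, ht'⟩, -⟩ := hh' χ
          have := (hle χ).1
          rw [hs', ht'] at this
          rw [map_sub, hs', ht', ← Complex.ofReal_sub, Complex.norm_real]
          simp only [Complex.ofReal_re] at this ⊢
          exact Real.norm_of_nonneg (sub_nonneg.mpr this)
        calc ‖χ (x + θ • (f - h'))‖ = ‖χ x + θ * χ (f - h')‖ := by
              rw [map_add, map_smul, smul_eq_mul]
          _ ≤ ‖χ x‖ + ‖θ * χ (f - h')‖ := norm_add_le _ _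
          _ = ‖χ x‖ + ((χ f).re - (χ h').re) := by rw [norm_mul, hθ, one_mul, hd]
          _ ≤ _ := by linarith [hx χ, (hle χ).2]
      · rw [map_add, map_smul, smul_eq_mul, hθω, Complex.add_re, Complex.ofReal_re]
        push_cast
        linarith
  obtain ⟨n, hn⟩ := exists_nat_gt (‖ω‖ / (ε / 2))
  obtain ⟨h, hh, x, hx, hωx⟩ := main n
  have hx1 : ‖x‖ ≤ 1 := norm_le_of_char zero_le_one fun χ => by
    obtain ⟨⟨s, hs, hs'⟩, -⟩ := hg χ
    obtain ⟨⟨t, ht, ht'⟩, -⟩ := hh χ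
    have := hx χ
    rw [hs', ht'] at this
    simp only [Complex.ofReal_re] at this
    linarith [hs.2, ht.1]
  have h1 : (ω x).re ≤ ‖ω‖ :=
    (Complex.re_le_norm _).trans ((ω.le_opNorm x).trans
      (mul_le_of_le_one_right (norm_nonneg _) hx1))
  rw [div_lt_iff₀ (by positivity)] at hn
  linarith

/-- The net `urysohn K` has exactly one weak* limit in the bidual of `M`. -/
theorem exists_unique_indicator {K : Set (characterSpace ℂ M)} (hK : IsCompact K) :
    ∃! p : StrongDual ℂ (StrongDual ℂ M),
      ∀ ω : StrongDual ℂ M, Tendsto (fun f => ω f) (urysohnFilter K) (𝓝 (p ω)) := by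
  have hne := urysohnFilter_neBot hK
  have hlim (ω : StrongDual ℂ M) : ∃ z : ℂ, Tendsto (fun f => ω f) (urysohnFilter K) (𝓝 z) :=
    CompleteSpace.complete (cauchy_urysohn hK ω)
  choose p hp using hlim
  have hev : ∀ᶠ f in urysohnFilter K, f ∈ urysohn K :=
    mem_of_superset ((urysohnFilter_hasBasis hK).mem_of_mem (urysohn_nonempty hK).some_mem)
      fun f hf => hf.1
  refine ⟨LinearMap.mkContinuous (𝕜 := ℂ)
    { toFun := p
      map_add' := fun ω ρ => tendsto_nhds_unique (hp _) ((hp ω).add (hp ρ))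
      map_smul' := fun r ω => tendsto_nhds_unique (hp _) ((hp ω).const_smul r) } 1 ?_,
    fun ω => hp ω, fun q hq => ContinuousLinearMap.ext fun ω => tendsto_nhds_unique (hq ω) (hp ω)⟩
  intro ω
  rw [one_mul]
  refine le_of_tendsto (hp ω).norm (hev.mono fun f hf => ?_)
  exact (ω.le_opNorm f).trans
    (mul_le_of_le_one_right (norm_nonneg _) (norm_le_one_of_urysohn hf))

/-- The indicator function `1_K` of a compact set `K ⊆ σ(M)` as an element of the bidual `M**`:
the weak* limit of the decreasing net of all `f ∈ M` with `0 ≤ f ≤ 1` and `f = 1` on `K`. -/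
def indicator (K : Compacts (characterSpace ℂ M)) : StrongDual ℂ (StrongDual ℂ M) :=
  (exists_unique_indicator K.isCompact).choose

theorem tendsto_indicator (K : Compacts (characterSpace ℂ M)) (ω : StrongDual ℂ M) :
    Tendsto (fun f => ω f) (urysohnFilter (K : Set (characterSpace ℂ M))) (𝓝 (indicator K ω)) :=
  (exists_unique_indicator K.isCompact).choose_spec.1 ω

end

/-! ### The product of the bidual of a C*-algebra

The product of the enveloping von Neumann algebra `B**` is the (first) Arens product. -/

section Bidual

/-- The topological bidual of a normed space. -/
abbrev Bidual (X : Type u) [NormedAddCommGroup X] [NormedSpace ℂ X] : Type u :=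
  StrongDual ℂ (StrongDual ℂ X)

variable {B : Type u} [CStarAlgebra B]

/-- The functional `φ · x : y ↦ φ (x y)`. -/
def dualMul (φ : StrongDual ℂ B) (x : B) : StrongDual ℂ B :=
  φ.comp (ContinuousLinearMap.mul ℂ B x)

/-- The functional `G · φ : x ↦ G (φ · x)`, as a continuous linear map in `φ`. -/
def bidualAct (G : Bidual B) : StrongDual ℂ B →L[ℂ] StrongDual ℂ B :=
  (ContinuousLinearMap.compL ℂ B (StrongDual ℂ B) ℂ G).comp
    (((ContinuousLinearMap.compL ℂ B (B →L[ℂ] B) (StrongDual ℂ B)).flip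
      (ContinuousLinearMap.mul ℂ B)).comp (ContinuousLinearMap.compL ℂ B B ℂ))

theorem bidualAct_apply (G : Bidual B) (φ : StrongDual ℂ B) (x : B) :
    bidualAct G φ x = G (dualMul φ x) := rfl

/-- The product of the von Neumann algebra `B**`: `(F G)(φ) = F (G · φ)`. -/
def bidualMul (F G : Bidual B) : Bidual B := F.comp (bidualAct G)

theorem bidualMul_apply (F G : Bidual B) (φ : StrongDual ℂ B) :
    bidualMul F G φ = F (bidualAct G φ) := rfl

/-- The canonical embedding of `B` in `B**`. -/
def toBidual (x : B) : Bidual B := NormedSpace.inclusionInDoubleDual ℂ B x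

theorem toBidual_mul (x y : B) : bidualMul (toBidual x) (toBidual y) = toBidual (x * y) := rfl

end Bidual

/-! ### Lipschitz pairs, topographies and Lipschitz triples -/

variable (A) in
/-- A Lipschitz pair: a seminorm `L` defined on a dense subspace `dom` of the self-adjoint part
of `𝔲A`, whose zero set is exactly the set of real multiples of the unit. -/
structure LipschitzPair where
  dom : Submodule ℝ (selfAdjoint (UnitalHull A))
  dense_dom : Dense (dom : Set (selfAdjoint (UnitalHull A)))
  L : Seminorm ℝ dom
  ker_L : {a : selfAdjoint (UnitalHull A) | ∃ h : a ∈ dom, L ⟨a, h⟩ = 0} =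
    Set.range fun r : ℝ => r • (1 : selfAdjoint (UnitalHull A))

variable (A) in
/-- A topography of `A`: an abelian C*-subalgebra `alg` of `A` containing an approximate identity
of `A`. (Since `alg` is a C*-algebra, it makes no difference whether approximate identities are
required to be bounded or increasing.) -/
structure Topography where
  alg : NonUnitalStarSubalgebra ℂ A
  isClosed_alg : IsClosed (alg : Set A)
  comm_alg : ∀ x ∈ alg, ∀ y ∈ alg, x * y = y * x
  exists_approximateUnit : ∃ l : Filter A, l.IsApproximateUnit ∧ (alg : Set A) ∈ l

variable (A) in
/-- A Lipschitz triple `(A, L, M)`. -/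
structure LipschitzTriple extends LipschitzPair A, Topography A

namespace LipschitzPair
variable (P : LipschitzPair A)

/-- The extended Monge-Kantorovich metric: the supremum of `|φ a - ψ a|` over the self-adjoint
`a ∈ A` in the domain of `L` with `L a ≤ 1`. -/
def mongeKantorovich (φ ψ : State A) : ℝ≥0∞ :=
  ⨆ a ∈ {a : A | IsSelfAdjoint a ∧
      ∃ d : P.dom, ((d : selfAdjoint (UnitalHull A)) : UnitalHull A) = UnitalHull.emb A a ∧
        P.L d ≤ 1},
    ‖φ.toDual a - ψ.toDual a‖ₑ

/-- The state space of `A` as an extended (pseudo)metric space for the Monge-Kantorovich metric. -/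
@[reducible] def mkMetric : PseudoEMetricSpace (State A) where
  edist := P.mongeKantorovich
  edist_self φ := by simp [mongeKantorovich]
  edist_comm φ ψ := by
    unfold mongeKantorovich
    simp_rw [← edist_eq_enorm_sub, edist_comm]
  edist_triangle φ ψ ρ := by
    refine iSup₂_le fun a ha => ?_
    rw [← edist_eq_enorm_sub]
    refine (edist_triangle _ (ψ.toDual a) _).trans (add_le_add ?_ ?_)
    · rw [edist_eq_enorm_sub]; exact le_iSup₂_of_le a ha le_rfl
    · rw [edist_eq_enorm_sub]; exact le_iSup₂_of_le a ha le_rfl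

/-- The set `𝔏₁(A, L, μ)` of all self-adjoint `x ∈ 𝔲A` with `L x ≤ 1` and `μ x = 0`. -/
def lipBall (μ : State A) : Set (UnitalHull A) :=
  {x | ∃ d : P.dom, ((d : selfAdjoint (UnitalHull A)) : UnitalHull A) = x ∧
    P.L d ≤ 1 ∧ μ.ext x = 0}

end LipschitzPair

namespace Topography
variable (T : Topography A)

instance : NonUnitalCommCStarAlgebra T.alg :=
  { NonUnitalStarSubalgebra.nonUnitalCStarAlgebra (h_closed := T.isClosed_alg) T.alg with
    mul_comm := fun x y => Subtype.ext (T.comm_alg x x.2 y y.2) }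

/-- The Gelfand spectrum `σ(M)` with the weak* topology. -/
abbrev Spectrum : Type u := characterSpace ℂ T.alg

/-- The inclusion of the topography `M` in `A`. -/
def inclusion : T.alg →L[ℂ] A := T.alg.toSubmodule.subtypeL

/-- The inclusion of the topography `M` in `𝔲A`. -/
def inclusionHull : T.alg →L[ℂ] UnitalHull A :=
  (⟨{ toFun := UnitalHull.emb A, map_add' := map_add _, map_smul' := map_smul _ },
    (AddMonoidHomClass.isometry_of_norm _ UnitalHull.norm_emb).continuous⟩ :
      A →L[ℂ] UnitalHull A).comp T.inclusion

/-- The restriction of a state of `A` to the topography `M`. -/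
def restrict (φ : State A) : StrongDual ℂ T.alg := φ.toDual.comp T.inclusion

/-- `1_K ∈ M**` as an element of `(𝔲A)**`, through the inclusion of `M**` given by the second
transpose of `M ⊆ 𝔲A`. It lies in the ideal `A**` of `(𝔲A)**`. -/
def indicatorHull (K : Compacts T.Spectrum) : Bidual (UnitalHull A) :=
  (indicator K).comp ((ContinuousLinearMap.compL ℂ T.alg (UnitalHull A) ℂ).flip T.inclusionHull)

/-- The set `𝒮(A|K)` of the states `φ` of `A` with `φ(1_K) = 1`. -/
def statesOn (K : Compacts T.Spectrum) : Set (State A) :=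
  {φ | indicator K (T.restrict φ) = 1}

/-- The local states of `A`. -/
def localStates : Set (State A) := ⋃ K : Compacts T.Spectrum, T.statesOn K

/-- The element `1_K x 1_K` of the enveloping von Neumann algebra, for `x ∈ 𝔲A`. -/
def corner (K : Compacts T.Spectrum) (x : UnitalHull A) : Bidual (UnitalHull A) :=
  bidualMul (bidualMul (T.indicatorHull K) (toBidual x)) (T.indicatorHull K)

/-- `a ∈ M ≅ C₀(σ(M))` has compact support. -/
def IsCompactlySupported (a : T.alg) : Prop :=
  HasCompactSupport fun χ : T.Spectrum => χ a

end Topography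

namespace LipschitzTriple
variable (T : LipschitzTriple A)

/-- A set `𝒦` of states is tame if, for some local state `μ`, the supremum of
`|φ(a - 1_K a 1_K)|` over `a ∈ 𝔏₁(A, L, μ)` and `φ ∈ 𝒦` tends to `0` along the directed set of
the compact subsets `K` of `σ(M)`, ordered by inclusion. -/
def IsTame (𝒦 : Set (State A)) : Prop :=
  ∃ μ ∈ T.localStates,
    Tendsto (fun K : Compacts T.Spectrum =>
        ⨆ a ∈ T.lipBall μ, ⨆ φ ∈ 𝒦, ‖(toBidual a - T.corner K a) (State.ext φ)‖ₑ)
      atTop (𝓝 0)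

/-- Regularity: every `𝒮(A|K)` has finite diameter for the Monge-Kantorovich metric. -/
def IsRegular : Prop :=
  ∀ K : Compacts T.Spectrum, (⨆ φ ∈ T.statesOn K, ⨆ ψ ∈ T.statesOn K, T.mongeKantorovich φ ψ) < ∞

/-- A quantum locally compact metric space: a regular Lipschitz triple such that the
Monge-Kantorovich metric induces the relative weak* topology on every tame set of states. -/
def IsQuantumLocallyCompactMetricSpace : Prop :=
  T.IsRegular ∧
  ∀ 𝒦 : Set (State A), T.IsTame 𝒦 →
    T.mkMetric.toUniformSpace.toTopologicalSpace.induced ((↑) : 𝒦 → State A) =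
      (inferInstance : TopologicalSpace 𝒦)

end LipschitzTriple
end QLCMS
end

noncomputable section
namespace QLCMS

open Filter Topology WeakDual TopologicalSpace
open scoped ENNReal ComplexOrder

universe u

/-! ### Positive functionals -/

section PositiveFunctionals

/-! Both directions compare `1_K x 1_K` with `f x f`, where `f ∈ M` is compactly supported, `0 ≤ f ≤
1` and `f = 1` on `K`. The corner at a state is bounded by `‖f x f‖` (`norm_corner_apply_le`).
Conversely, for self-adjoint `x`, the norm `‖f x f‖` is bounded by the values of `x` at the states
concentrated on a compact set containing the support of `f` (`norm_compression_le`): a state of `𝔲A`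
norming `f x f`, compressed by `f`, is a multiple, with factor at most one, of such a state.

Suppose the sets `a 𝔏₁ b` are totally bounded for one local `μ`. They are then bounded, which gives
regularity and lets `μ` be replaced by any other local state, since the change of base point only
adds bounded multiples of `ab`. On a tame set `x` may be replaced by its corner, uniformly in `x ∈
𝔏₁`, so a finite net of `f 𝔏₁ f` reduces closeness in the Monge-Kantorovich metric to closeness at
finitely many elements, a weak* condition. That the metric topology is finer than the weak* one
holds for every Lipschitz pair, because the domain of `L` is dense (`exists_dist_apply_lt`).

Conversely, `𝒮(A|K)` is tame, as its states do not see the difference between `x` and `1_K x 1_K`,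
and it is weak* compact. The metric therefore has finite nets `t` on it. By regularity the
evaluations of `𝔏₁` at `t` form a bounded subset of a finite-dimensional space, so finitely many
elements of `𝔏₁` approximate all others at `t`, hence uniformly on `𝒮(A|K)`, hence in the norm of `f
· f`. For general `a`, `b` take `f = 1` on both supports, so that `a x b = a (f x f) b`. -/

theorem norm_apply_star_mul_le {B : Type u} [NonUnitalCStarAlgebra B] {G : StrongDual ℂ B}
    (hG : ∀ a, 0 ≤ G (star a * a)) (a b : B) :
    ‖G (star a * b)‖ ≤ √(G (star a * a)).re * √(G (star b * b)).re := by
  let _ := CStarAlgebra.spectralOrder B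
  have := CStarAlgebra.spectralOrderedRing B
  let f : B →ₚ[ℂ] ℂ := PositiveLinearMap.mk₀ (G : B →ₗ[ℂ] ℂ) (by
    intro x hx
    obtain ⟨y, rfl⟩ := CStarAlgebra.nonneg_iff_eq_star_mul_self.mp hx
    exact hG y)
  exact norm_inner_le_norm (𝕜 := ℂ) (f.toPreGNS a) (f.toPreGNS b)

theorem apply_star_mul_eq_zero {B : Type u} [NonUnitalCStarAlgebra B] {G : StrongDual ℂ B}
    (hG : ∀ a, 0 ≤ G (star a * a)) {a : B} (ha : G (star a * a) = 0) (b : B) :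
    G (star a * b) = 0 := by
  have h := norm_apply_star_mul_le hG a b
  rw [ha, Complex.zero_re, Real.sqrt_zero, zero_mul] at h
  exact norm_le_zero_iff.mp h

theorem apply_mul_eq_zero {B : Type u} [NonUnitalCStarAlgebra B] {G : StrongDual ℂ B}
    (hG : ∀ a, 0 ≤ G (star a * a)) {a : B} (ha : G (star a * a) = 0) (b : B) :
    G (b * a) = 0 := by
  have h := norm_apply_star_mul_le hG (star b) a
  rw [ha, Complex.zero_re, Real.sqrt_zero, mul_zero, star_star] at h
  exact norm_le_zero_iff.mp h

variable {B : Type u} [CStarAlgebra B]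

/-- This is `x* x ≤ ‖x‖² 1` with the difference written as a square, so that functionals positive on
squares can be applied without choosing an order. -/
theorem star_mul_self_bound (x : B) : ∃ y : B, star x * x + star y * y = ((‖x‖ : ℂ) ^ 2) • 1 := by
  let _ := CStarAlgebra.spectralOrder B
  have := CStarAlgebra.spectralOrderedRing B
  have h := CStarAlgebra.star_mul_le_algebraMap_norm_sq (a := x)
  obtain ⟨y, hy⟩ := CStarAlgebra.nonneg_iff_eq_star_mul_self.mp (sub_nonneg.mpr h)
  refine ⟨y, ?_⟩
  rw [← hy, Algebra.algebraMap_eq_smul_one, add_sub_cancel]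
  rw [← Complex.coe_smul]
  norm_cast

/-- Cauchy–Schwarz against `1`, followed by `G (x* x) ≤ ‖x‖² G 1`. -/
theorem norm_apply_le_of_positive {G : StrongDual ℂ B} (hG : ∀ a, 0 ≤ G (star a * a)) (x : B) :
    ‖G x‖ ≤ (G 1).re * ‖x‖ := by
  have h1 : 0 ≤ (G 1).re := by
    simpa using (Complex.nonneg_iff.mp (hG 1)).1
  have h := norm_apply_star_mul_le hG 1 x
  rw [star_one, one_mul, one_mul] at h
  obtain ⟨y, hy⟩ := star_mul_self_bound x
  have h2 : (G (star x * x)).re ≤ (G 1).re * ‖x‖ ^ 2 := by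
    have := congrArg (fun z => (G z).re) hy
    simp only [map_add, map_smul, Complex.add_re, smul_eq_mul] at this
    have h3 := (Complex.nonneg_iff.mp (hG y)).1
    rw [← Complex.ofReal_pow, Complex.re_ofReal_mul] at this
    linarith
  refine h.trans ?_
  rw [← Real.sqrt_mul h1]
  refine Real.sqrt_le_iff.mpr ⟨by positivity, ?_⟩
  nlinarith

/-- Shift by `it`: `|Im g(h) + t|² ≤ ‖h + it‖² ≤ ‖h‖² + t²`. The terms `t²` cancel, leaving a bound
on `2 t Im g(h)` for all real `t`. -/
theorem im_apply_eq_zero {g : StrongDual ℂ B} (h1 : g 1 = 1) (hn : ‖g‖ ≤ 1) {h : B}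
    (hh : IsSelfAdjoint h) : (g h).im = 0 := by
  have key (t : ℝ) : 2 * t * (g h).im ≤ ‖h‖ ^ 2 := by
    set w : B := h + ((t : ℂ) * Complex.I) • 1 with hw
    have hww : star w * w = h * h + ((t : ℂ) ^ 2) • (1 : B) := by
      have e : star w = h - ((t : ℂ) * Complex.I) • (1 : B) := by
        rw [hw, star_add, hh.star_eq, star_smul, star_one]
        simp [sub_eq_add_neg]
      rw [e, hw]
      simp only [sub_mul, mul_add, smul_mul_assoc, mul_smul_comm, one_mul, mul_one, smul_smul,
        smul_sub]
      have : (t : ℂ) * Complex.I * (t * Complex.I) = - (t : ℂ) ^ 2 := by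
        linear_combination (t : ℂ) ^ 2 * Complex.I_sq
      rw [this, neg_smul]
      abel
    have hnw : ‖w‖ ^ 2 ≤ ‖h‖ ^ 2 + t ^ 2 := by
      rw [sq, ← CStarRing.norm_star_mul_self, hww]
      refine (norm_add_le _ _).trans (add_le_add ?_ ?_)
      · rw [sq]; exact norm_mul_le _ _
      · rw [norm_smul]
        have : ‖(1 : B)‖ ≤ 1 := by
          rcases subsingleton_or_nontrivial B with hB | hB
          · rw [Subsingleton.elim (1 : B) 0, norm_zero]; exact zero_le_one
          · exact CStarRing.norm_one.le
        refine (mul_le_of_le_one_right (norm_nonneg _) this).trans ?_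
        simp
    have hgw : ‖g w‖ ≤ ‖w‖ := (g.le_opNorm w).trans (mul_le_of_le_one_left (norm_nonneg _) hn)
    have him : (g w).im = (g h).im + t := by
      rw [hw, map_add, map_smul, h1]; simp
    have hb := (Complex.abs_im_le_norm (g w)).trans hgw
    rw [him] at hb
    have := (sq_le_sq₀ (abs_nonneg _) (norm_nonneg _)).mpr hb
    rw [sq_abs] at this
    nlinarith [sq_nonneg (g h).im]
  by_contra hne
  -- This `t` makes the left side of `key` equal to `‖h‖² + 1`.
  have := key ((‖h‖ ^ 2 + 1) / (2 * (g h).im))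
  rw [mul_div_assoc', div_mul_eq_mul_div, mul_right_comm, mul_div_assoc,
    mul_comm (2 * (g h).im), div_mul_cancel₀ _ (by simpa using hne)] at this
  linarith

/-- Write `a* a = ‖a‖² 1 - y* y`; since `0 ≤ y* y ≤ ‖a‖² 1`, the value of `g` at `y* y` is at most
`‖a‖²` in modulus. -/
theorem nonneg_of_norm_le_one {g : StrongDual ℂ B} (h1 : g 1 = 1) (hn : ‖g‖ ≤ 1) (a : B) :
    0 ≤ g (star a * a) := by
  refine Complex.nonneg_iff.mpr ⟨?_, (im_apply_eq_zero h1 hn (IsSelfAdjoint.star_mul_self a)).symm⟩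
  obtain ⟨y, hy⟩ := star_mul_self_bound a
  let _ := CStarAlgebra.spectralOrder B
  have := CStarAlgebra.spectralOrderedRing B
  have hle : ‖star y * y‖ ≤ ‖a‖ ^ 2 := by
    have : ‖star y * y‖ ≤ ‖((‖a‖ : ℂ) ^ 2) • (1 : B)‖ := by
      refine CStarAlgebra.norm_le_norm_of_nonneg_of_le (star_mul_self_nonneg y) ?_
      rw [← hy]
      exact le_add_of_nonneg_left (star_mul_self_nonneg a)
    refine this.trans ?_
    rw [norm_smul]
    have : ‖(1 : B)‖ ≤ 1 := by
      rcases subsingleton_or_nontrivial B with hB | hB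
      · rw [Subsingleton.elim (1 : B) 0, norm_zero]; exact zero_le_one
      · exact CStarRing.norm_one.le
    refine (mul_le_of_le_one_right (norm_nonneg _) this).trans ?_
    simp
  have h2 : (g (star y * y)).re ≤ ‖a‖ ^ 2 :=
    (Complex.re_le_norm _).trans (((g.le_opNorm _).trans
      (mul_le_of_le_one_left (norm_nonneg _) hn)).trans hle)
  have := congrArg (fun z => (g z).re) hy
  simp only [map_add, map_smul, Complex.add_re, smul_eq_mul, h1, mul_one] at this
  rw [← Complex.ofReal_pow, Complex.ofReal_re] at this
  linarith

/-- A nonzero self-adjoint element attains its norm at a state of the unital algebra `B`. -/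
theorem exists_norming_state {z : B} (hz : IsSelfAdjoint z) (h0 : z ≠ 0) :
    ∃ g : StrongDual ℂ B, g 1 = 1 ∧ (∀ a, 0 ≤ g (star a * a)) ∧ ‖g z‖ = ‖z‖ := by
  have : Nontrivial B := ⟨z, 0, h0⟩
  obtain ⟨s, hs, hmem⟩ : ∃ s : ℝ, |s| = 1 ∧ s * ‖z‖ ∈ spectrum ℝ z := by
    rcases CStarAlgebra.norm_or_neg_norm_mem_spectrum hz with h | h
    · exact ⟨1, abs_one, by simpa using h⟩
    · exact ⟨-1, by simp, by simpa using h⟩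
  have hss : s * s = 1 := by rw [← abs_mul_abs_self, hs, one_mul]
  set w : B := algebraMap ℝ B (s * ‖z‖) + z with hw
  have hw2 : 2 * ‖z‖ ≤ ‖w‖ := by
    have h2 : s * ‖z‖ + s * ‖z‖ ∈ spectrum ℝ w :=
      (spectrum.add_mem_add_iff).mpr hmem
    have := spectrum.norm_le_norm_of_mem h2
    rw [← mul_add, norm_mul, Real.norm_eq_abs, hs, one_mul, ← two_mul,
      Real.norm_of_nonneg (by positivity)] at this
    exact this
  obtain ⟨g₀, hg₀, hg₀w⟩ := exists_dual_vector'' ℂ w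
  have hz0 : 0 < ‖z‖ := norm_pos_iff.mpr h0
  have hgw : g₀ w = (s * ‖z‖ : ℂ) * g₀ 1 + g₀ z := by
    rw [hw, map_add, Algebra.algebraMap_eq_smul_one, ← Complex.coe_smul, map_smul]
    simp
  have hb (x : B) : ‖g₀ x‖ ≤ ‖x‖ := (g₀.le_opNorm x).trans (mul_le_of_le_one_left (norm_nonneg _) hg₀)
  have hb1 := hb 1
  rw [CStarRing.norm_one] at hb1
  have hre : 2 * ‖z‖ ≤ (s * ‖z‖) * (g₀ 1).re + (g₀ z).re := by
    have := congrArg Complex.re (hg₀w.symm.trans hgw)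
    rw [Complex.add_re, ← Complex.ofReal_mul, Complex.re_ofReal_mul] at this
    rw [← this]
    simpa using hw2
  have hzre := (Complex.re_le_norm (g₀ z)).trans (hb z)
  have hone : 1 ≤ s * (g₀ 1).re := by nlinarith
  have hs1 : s * (g₀ 1).re ≤ 1 := by
    refine (le_abs_self _).trans ?_
    rw [abs_mul, hs, one_mul]
    exact (Complex.abs_re_le_norm _).trans hb1
  have hr : (g₀ 1).re = s := by
    have := le_antisymm hs1 hone
    calc (g₀ 1).re = s * s * (g₀ 1).re := by rw [hss, one_mul]
      _ = s := by rw [mul_assoc, this, mul_one]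
  have him : (g₀ 1).im = 0 := by
    have h3 := Complex.sq_norm (g₀ 1)
    rw [Complex.normSq_apply, hr, hss] at h3
    have : ‖g₀ 1‖ ^ 2 ≤ 1 := pow_le_one₀ (norm_nonneg _) hb1
    nlinarith [mul_self_nonneg (g₀ 1).im]
  have hg1 : g₀ 1 = s := Complex.ext hr (by simpa using him)
  have h1 : ((s : ℂ) • g₀) 1 = 1 := by
    change (s : ℂ) * g₀ 1 = 1
    rw [hg1]; exact_mod_cast hss
  have hn : ‖(s : ℂ) • g₀‖ ≤ 1 := by
    rw [norm_smul, Complex.norm_real, Real.norm_eq_abs, hs, one_mul]; exact hg₀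
  refine ⟨(s : ℂ) • g₀, h1, nonneg_of_norm_le_one h1 hn, le_antisymm ?_ ?_⟩
  · exact (ContinuousLinearMap.le_opNorm _ z).trans (mul_le_of_le_one_left (norm_nonneg _) hn)
  · have h5 : ‖z‖ ≤ (g₀ z).re := by
      rw [mul_right_comm, hr, hss, one_mul] at hre; linarith
    change ‖z‖ ≤ ‖(s : ℂ) * g₀ z‖
    rw [norm_mul, Complex.norm_real, Real.norm_eq_abs, hs, one_mul]
    exact h5.trans (Complex.re_le_norm _)

end PositiveFunctionals

/-! ### Extensions of states -/

section Extensions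
variable {A : Type u} [NonUnitalCStarAlgebra A]

/-- Cauchy–Schwarz against the unit, with an approximate unit in its place. This is the inequality
that makes the extension to `𝔲A` positive. -/
theorem State.norm_apply_sq_le (φ : State A) (a : A) :
    ‖φ.toDual a‖ ^ 2 ≤ (φ.toDual (star a * a)).re := by
  let _ := CStarAlgebra.spectralOrder A
  have := CStarAlgebra.spectralOrderedRing A
  have hl := CStarAlgebra.increasingApproximateUnit A
  have hnn : 0 ≤ (φ.toDual (star a * a)).re := (Complex.nonneg_iff.mp (φ.nonneg a)).1
  have hev : ∀ᶠ e in CStarAlgebra.approximateUnit A,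
      ‖φ.toDual (e * a)‖ ≤ √(φ.toDual (star a * a)).re := by
    filter_upwards [hl.eventually_star_eq, hl.eventually_norm] with e he hen
    have h := φ.cauchySchwarz e a
    rw [he] at h
    refine h.trans (mul_le_of_le_one_left (Real.sqrt_nonneg _) (Real.sqrt_le_one.mpr ?_))
    refine (Complex.re_le_norm _).trans ((φ.toDual.le_opNorm _).trans ?_)
    rw [φ.norm_toDual, one_mul]
    exact (norm_mul_le _ _).trans (mul_le_one₀ hen (norm_nonneg _) hen)
  have ht : Tendsto (fun e => ‖φ.toDual (e * a)‖) (CStarAlgebra.approximateUnit A)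
      (𝓝 ‖φ.toDual a‖) :=
    ((φ.toDual.continuous.tendsto a).comp (hl.tendsto_mul_right a)).norm
  have h := le_of_tendsto ht hev
  calc ‖φ.toDual a‖ ^ 2 ≤ √(φ.toDual (star a * a)).re ^ 2 :=
        pow_le_pow_left₀ (norm_nonneg _) h 2
    _ = _ := Real.sq_sqrt hnn

theorem State.apply_star (φ : State A) (a : A) : φ.toDual (star a) = star (φ.toDual a) := by
  let _ := CStarAlgebra.spectralOrder A
  have := CStarAlgebra.spectralOrderedRing A
  let f : A →ₚ[ℂ] ℂ := PositiveLinearMap.mk₀ (φ.toDual : A →ₗ[ℂ] ℂ) (by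
    intro x hx
    obtain ⟨y, rfl⟩ := CStarAlgebra.nonneg_iff_eq_star_mul_self.mp hx
    exact φ.nonneg y)
  exact map_star f a

theorem State.ext_nonneg (φ : State A) (x : UnitalHull A) : 0 ≤ φ.ext (star x * x) := by
  obtain ⟨a, r, rfl⟩ := UnitalHull.exists_eq x
  have e : star (UnitalHull.emb A a + r • 1) * (UnitalHull.emb A a + r • 1) =
      UnitalHull.emb A (star a * a) + r • UnitalHull.emb A (star a) + star r • UnitalHull.emb A a
        + (star r * r) • 1 := by
    simp only [star_add, star_smul, star_one, map_mul, map_star, add_mul, mul_add, smul_mul_assoc,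
      mul_smul_comm, one_mul, mul_one, smul_add, smul_smul]
    rw [mul_comm r]
    abel
  rw [e]
  simp only [map_add, map_smul, φ.ext_one, φ.ext_emb, φ.apply_star, smul_eq_mul, mul_one]
  obtain ⟨hre, him⟩ := Complex.nonneg_iff.mp (φ.nonneg a)
  have hsq := φ.norm_apply_sq_le a
  rw [Complex.sq_norm, Complex.normSq_apply] at hsq
  -- By `|φ a|² ≤ φ(a* a)`, the value at `(a + r)* (a + r)` is at least `|φ a + r|²`.
  refine Complex.nonneg_iff.mpr ⟨?_, ?_⟩
  · simp
    nlinarith [sq_nonneg ((φ.toDual a).re + r.re), sq_nonneg ((φ.toDual a).im + r.im)]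
  · simp [← him]
    ring

theorem State.norm_ext_apply_le (φ : State A) (x : UnitalHull A) : ‖φ.ext x‖ ≤ ‖x‖ := by
  have := norm_apply_le_of_positive φ.ext_nonneg x
  rwa [φ.ext_one, Complex.one_re, one_mul] at this

theorem State.ext_unique (φ : State A) {ψ : StrongDual ℂ (UnitalHull A)} (h1 : ψ 1 = 1)
    (h : ∀ a, ψ (UnitalHull.emb A a) = φ.toDual a) : ψ = φ.ext :=
  φ.exists_unique_extension.unique ⟨h1, h⟩ ⟨φ.ext_one, φ.ext_emb⟩

theorem State.im_ext_apply (φ : State A) {x : UnitalHull A} (hx : IsSelfAdjoint x) :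
    (φ.ext x).im = 0 :=
  im_apply_eq_zero φ.ext_one
    (φ.ext.opNorm_le_bound zero_le_one fun x => by rw [one_mul]; exact φ.norm_ext_apply_le x) hx

end Extensions

/-! ### Functions in an abelian C*-algebra -/

section Abelian
variable {M : Type u} [NonUnitalCommCStarAlgebra M]

/-- The character of the unitization that vanishes on `M`. -/
def charInfty (M : Type u) [NonUnitalCommCStarAlgebra M] : characterSpace ℂ (Unitization ℂ M) :=
  CharacterSpace.equivAlgHom.symm (Unitization.fstHom ℂ M)

theorem charInfty_apply (x : Unitization ℂ M) : charInfty M x = x.fst := rfl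

/-- Gelfand duality for the unitization: the preimage of a function vanishing at infinity has no
scalar part. -/
theorem exists_forall_char_eq (F : C(characterSpace ℂ (Unitization ℂ M), ℂ))
    (hF : F (charInfty M) = 0) : ∃ y : M, ∀ χ : characterSpace ℂ M, χ y = F (liftChar χ) := by
  obtain ⟨y, hy⟩ := (gelfandTransform_bijective (Unitization ℂ M)).2 F
  have hy' (ψ : characterSpace ℂ (Unitization ℂ M)) : ψ y = F ψ := congrArg (· ψ) hy
  have hfst : y.fst = 0 := by rw [← charInfty_apply, hy', hF]
  exact ⟨y.snd, fun χ => by rw [← hy', liftChar_apply, hfst, zero_add]⟩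

theorem eq_of_forall_char {x y : M} (h : ∀ χ : characterSpace ℂ M, χ x = χ y) : x = y := by
  have := norm_le_of_char (x := x - y) le_rfl fun χ => by rw [map_sub, h, sub_self, norm_zero]
  exact sub_eq_zero.mp (norm_le_zero_iff.mp this)

theorem char_star (χ : characterSpace ℂ M) (x : M) : χ (star x) = star (χ x) := by
  have h (y : M) : χ y = liftChar χ (Unitization.inr y) := by simp [liftChar_apply]
  rw [h, h, Unitization.inr_star, map_star]

/-- The functional calculus of an element of `M`, in terms of characters. -/
theorem exists_char_comp (g : M) {h : ℂ → ℂ} (hh : Continuous h) (h0 : h 0 = 0) :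
    ∃ y : M, ∀ χ : characterSpace ℂ M, χ y = h (χ g) := by
  obtain ⟨y, hy⟩ := exists_forall_char_eq (M := M)
    ⟨fun ψ => h (gelfandTransform ℂ _ (Unitization.inr g : Unitization ℂ M) ψ),
      hh.comp (map_continuous _)⟩ (by
        change h (charInfty M (Unitization.inr g)) = 0
        rw [charInfty_apply, Unitization.fst_inr, h0])
  refine ⟨y, fun χ => (hy χ).trans ?_⟩
  change h (liftChar χ (Unitization.inr g)) = _
  rw [liftChar_apply, Unitization.fst_inr, Unitization.snd_inr, zero_add]

theorem exists_eq_star_mul_self {y : M} (hy : ∀ χ : characterSpace ℂ M, 0 ≤ χ y) :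
    ∃ b : M, y = star b * b := by
  obtain ⟨b, hb⟩ := exists_char_comp y (h := fun z => (√z.re : ℂ)) (by fun_prop) (by simp)
  refine ⟨b, eq_of_forall_char fun χ => ?_⟩
  obtain ⟨h1, h2⟩ := Complex.nonneg_iff.mp (hy χ)
  rw [map_mul, char_star, hb]
  refine Complex.ext ?_ ?_
  · simp [Real.mul_self_sqrt h1]
  · simp [← h2]

/-- Multiplicative functionals in the weak* compact unit ball are characters or `0`, and `c ≤ ‖χ g‖`
excludes `0`, so the set is closed in the ball. -/
theorem isCompact_setOf_le_norm_char (g : M) {c : ℝ} (hc : 0 < c) :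
    IsCompact {χ : characterSpace ℂ M | c ≤ ‖χ g‖} := by
  rw [Subtype.isCompact_iff]
  refine (WeakDual.isCompact_closedBall (𝕜 := ℂ) (E := M) 0 1).of_isClosed_subset
    (t := ((↑) : characterSpace ℂ M → WeakDual ℂ M) '' {χ | c ≤ ‖χ g‖}) ?_ ?_
  · have : ((↑) : characterSpace ℂ M → WeakDual ℂ M) '' {χ | c ≤ ‖χ g‖} =
        (⋂ (x : M) (y : M), {φ : WeakDual ℂ M | φ (x * y) = φ x * φ y}) ∩ {φ | c ≤ ‖φ g‖} := by
      ext φ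
      simp only [Set.mem_image, Set.mem_ofPred_eq, Set.mem_inter_iff, Set.mem_iInter]
      constructor
      · rintro ⟨χ, hχ, rfl⟩
        exact ⟨fun x y => χ.2.2 x y, hχ⟩
      · rintro ⟨hm, hg⟩
        refine ⟨⟨φ, ?_, hm⟩, hg, rfl⟩
        rintro rfl
        have : ‖(0 : ℂ)‖ ≥ c := hg
        rw [norm_zero] at this
        linarith
    rw [this]
    refine (isClosed_iInter fun x => isClosed_iInter fun y => ?_).inter ?_
    · exact isClosed_eq (WeakDual.eval_continuous _)
        ((WeakDual.eval_continuous _).mul (WeakDual.eval_continuous _))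
    · exact isClosed_le continuous_const (WeakDual.eval_continuous g).norm
  · rintro _ ⟨χ, -, rfl⟩
    simp only [Set.mem_preimage, mem_closedBall_zero_iff]
    refine ContinuousLinearMap.opNorm_le_bound _ zero_le_one fun x => ?_
    have h := spectrum.norm_le_norm_of_mem
      (CharacterSpace.apply_mem_spectrum (liftChar χ) (Unitization.inr x : Unitization ℂ M))
    rw [liftChar_apply, Unitization.fst_inr, Unitization.snd_inr, zero_add,
      Unitization.norm_inr] at h
    rw [one_mul]
    exact h

theorem exists_urysohn_hasCompactSupport {K : Set (characterSpace ℂ M)} (hK : IsCompact K) :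
    ∃ f ∈ urysohn K, HasCompactSupport fun χ : characterSpace ℂ M => χ f := by
  obtain ⟨g, hg⟩ := urysohn_nonempty hK
  -- The truncation `max 0 (2 g - 1)` keeps the value `1` on `K` and vanishes where `g < 1/2`.
  obtain ⟨f, hf⟩ := exists_char_comp g (h := fun z => ((max 0 (2 * z.re - 1) : ℝ) : ℂ))
    (by fun_prop) (by simp)
  refine ⟨f, fun χ => ?_, ?_⟩
  · obtain ⟨⟨t, ht, h⟩, h1⟩ := hg χ
    refine ⟨⟨_, ⟨le_max_left _ _, max_le zero_le_one ?_⟩, hf χ⟩, fun hχ => ?_⟩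
    · rw [h, Complex.ofReal_re]; linarith [ht.2]
    · rw [hf, h1 hχ]; norm_num
  · refine HasCompactSupport.intro (isCompact_setOf_le_norm_char g one_half_pos) fun χ hχ => ?_
    obtain ⟨⟨t, ht, h⟩, -⟩ := hg χ
    rw [Set.mem_ofPred_eq, not_le, h, Complex.norm_real, Real.norm_of_nonneg ht.1] at hχ
    rw [hf, h, Complex.ofReal_re, max_eq_left (by linarith), Complex.ofReal_zero]

theorem star_eq_of_urysohn {K : Set (characterSpace ℂ M)} {f : M} (hf : f ∈ urysohn K) :
    star f = f :=
  eq_of_forall_char fun χ => by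
    obtain ⟨⟨t, -, h⟩, -⟩ := hf χ
    rw [char_star, h]
    simp

theorem urysohn_mul_eq {K : Set (characterSpace ℂ M)} {f a : M} (hf : f ∈ urysohn K)
    (ha : (Function.support fun χ : characterSpace ℂ M => χ a) ⊆ K) : f * a = a :=
  eq_of_forall_char fun χ => by
    rw [map_mul]
    by_cases h : χ a = 0
    · rw [h, mul_zero]
    · rw [(hf χ).2 (ha h), one_mul]

theorem urysohn_anti {K K' : Set (characterSpace ℂ M)} (h : K ⊆ K') : urysohn K' ⊆ urysohn K :=
  fun _ hf χ => ⟨(hf χ).1, fun hχ => (hf χ).2 (h hχ)⟩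

theorem eventually_mem_urysohn {K : Set (characterSpace ℂ M)} (hK : IsCompact K) :
    ∀ᶠ f in urysohnFilter K, f ∈ urysohn K :=
  mem_of_superset ((urysohnFilter_hasBasis hK).mem_of_mem (urysohn_nonempty hK).some_mem)
    fun _ hf => hf.1

theorem tendsto_mul_urysohnFilter {K : Set (characterSpace ℂ M)} (hK : IsCompact K) {f₀ : M}
    (h₀ : f₀ ∈ urysohn K) : Tendsto (fun f => f * f₀) (urysohnFilter K) (urysohnFilter K) := by
  refine ((urysohnFilter_hasBasis hK).tendsto_iff (urysohnFilter_hasBasis hK)).mpr fun g hg =>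
    ⟨g, hg, fun f hf => ?_⟩
  obtain ⟨h1, h2⟩ := urysohn_mul hf.1 h₀
  exact ⟨h1, fun χ => (h2 χ).1.trans (hf.2 χ)⟩

theorem indicator_eq_of_forall {K : Compacts (characterSpace ℂ M)} {ω : StrongDual ℂ M} {c : ℂ}
    (h : ∀ f ∈ urysohn (K : Set (characterSpace ℂ M)), ω f = c) : indicator K ω = c := by
  have := urysohnFilter_neBot K.isCompact
  exact tendsto_nhds_unique (tendsto_indicator K ω)
    (tendsto_const_nhds.congr' ((eventually_mem_urysohn K.isCompact).mono fun f hf => (h f hf).symm))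

/-- The products `f * f₀` run cofinally down the net, so only they need to be estimated. This lets
`f₀` be factored out of a limit. -/
theorem norm_indicator_le {K : Compacts (characterSpace ℂ M)} {ω : StrongDual ℂ M} {C : ℝ} {f₀ : M}
    (h₀ : f₀ ∈ urysohn (K : Set (characterSpace ℂ M)))
    (h : ∀ f ∈ urysohn (K : Set (characterSpace ℂ M)), ‖ω (f * f₀)‖ ≤ C) :
    ‖indicator K ω‖ ≤ C := by
  have := urysohnFilter_neBot K.isCompact
  exact le_of_tendsto
    ((tendsto_indicator K ω).comp (tendsto_mul_urysohnFilter K.isCompact h₀)).norm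
    ((eventually_mem_urysohn K.isCompact).mono h)

end Abelian

variable {A : Type u} [NonUnitalCStarAlgebra A]

/-! ### States on compact sets and corners -/

theorem State.isInducing_val :
    IsInducing (X := State A) (Y := WeakDual ℂ A) (fun φ => φ.1) := ⟨rfl⟩

namespace Topography
variable (T : Topography A)

theorem inclusionHull_mul (a b : T.alg) :
    T.inclusionHull (a * b) = T.inclusionHull a * T.inclusionHull b :=
  map_mul (UnitalHull.emb A) (a : A) b

theorem inclusionHull_star (a : T.alg) : T.inclusionHull (star a) = star (T.inclusionHull a) :=
  map_star (UnitalHull.emb A) (a : A)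

theorem norm_inclusionHull (a : T.alg) : ‖T.inclusionHull a‖ = ‖a‖ := UnitalHull.norm_emb (a : A)

variable {T}

theorem ext_inclusionHull (φ : State A) (a : T.alg) :
    φ.ext (T.inclusionHull a) = T.restrict φ a := φ.ext_emb a

theorem restrict_nonneg (φ : State A) {y : T.alg} (hy : ∀ χ : T.Spectrum, 0 ≤ χ y) :
    0 ≤ T.restrict φ y := by
  obtain ⟨b, rfl⟩ := exists_eq_star_mul_self hy
  exact φ.nonneg (b : A)

theorem norm_restrict_apply_le (φ : State A) (y : T.alg) : ‖T.restrict φ y‖ ≤ ‖y‖ := by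
  have := φ.toDual.le_opNorm (y : A)
  rwa [φ.norm_toDual, one_mul] at this

/-- A state is concentrated on `K` iff it takes the value `1` at all `f ∈ M` with `0 ≤ f ≤ 1` and
`f = 1` on `K`. -/
theorem mem_statesOn_iff {K : Compacts T.Spectrum} {φ : State A} :
    φ ∈ T.statesOn K ↔ ∀ f ∈ urysohn (K : Set T.Spectrum), T.restrict φ f = 1 := by
  refine ⟨fun h f hf => ?_, fun h => indicator_eq_of_forall h⟩
  have := urysohnFilter_neBot K.isCompact
  have hlim := tendsto_indicator K (T.restrict φ)
  rw [show indicator K (T.restrict φ) = 1 from h] at hlim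
  -- The net decreases to the limit `1`, and `f` dominates everything below it; the reverse bound is
  -- `‖f‖ ≤ 1`.
  have hle : 1 ≤ T.restrict φ f := by
    refine le_of_tendsto hlim ?_
    filter_upwards [(urysohnFilter_hasBasis K.isCompact).mem_of_mem hf] with g hg
    rw [← sub_nonneg, ← map_sub]
    refine restrict_nonneg φ fun χ => ?_
    obtain ⟨⟨s, -, hs⟩, -⟩ := hf χ
    obtain ⟨⟨t, -, ht⟩, -⟩ := hg.1 χ
    have := hg.2 χ
    rw [hs, ht] at this
    rw [map_sub, hs, ht, ← Complex.ofReal_sub]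
    simp only [Complex.ofReal_re] at this
    exact_mod_cast sub_nonneg.mpr this
  have hn := (norm_restrict_apply_le φ f).trans (norm_le_one_of_urysohn hf)
  obtain ⟨h1, h2⟩ := Complex.le_def.mp hle
  exact Complex.ext (le_antisymm ((Complex.re_le_norm _).trans hn) h1) h2.symm

theorem statesOn_mono {K K' : Compacts T.Spectrum} (h : K ≤ K') : T.statesOn K ⊆ T.statesOn K' :=
  fun _ hφ => mem_statesOn_iff.mpr fun f hf => mem_statesOn_iff.mp hφ f (urysohn_anti h hf)

/-- Since `f` and `f * f` both have value `1`, the element `1 - f` lies in the null space of the GNS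
form of `φ`. Hence `f` can be inserted or removed on either side. -/
theorem ext_star_mul_self_one_sub {K : Compacts T.Spectrum} {φ : State A} (hφ : φ ∈ T.statesOn K)
    {f : T.alg} (hf : f ∈ urysohn (K : Set T.Spectrum)) :
    φ.ext (star (1 - T.inclusionHull f) * (1 - T.inclusionHull f)) = 0 := by
  rw [star_sub, star_one, ← inclusionHull_star, star_eq_of_urysohn hf]
  simp only [sub_mul, mul_sub, one_mul, mul_one, ← inclusionHull_mul, map_sub, φ.ext_one,
    ext_inclusionHull]
  rw [mem_statesOn_iff.mp hφ f hf, mem_statesOn_iff.mp hφ _ (urysohn_mul hf hf).1]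
  simp

theorem ext_mul_urysohn {K : Compacts T.Spectrum} {φ : State A} (hφ : φ ∈ T.statesOn K)
    {f : T.alg} (hf : f ∈ urysohn (K : Set T.Spectrum)) (x : UnitalHull A) :
    φ.ext (x * T.inclusionHull f) = φ.ext x := by
  have := apply_mul_eq_zero φ.ext_nonneg (ext_star_mul_self_one_sub hφ hf) x
  rw [mul_sub, mul_one, map_sub] at this
  exact (sub_eq_zero.mp this).symm

theorem ext_urysohn_mul {K : Compacts T.Spectrum} {φ : State A} (hφ : φ ∈ T.statesOn K)
    {f : T.alg} (hf : f ∈ urysohn (K : Set T.Spectrum)) (x : UnitalHull A) :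
    φ.ext (T.inclusionHull f * x) = φ.ext x := by
  have := apply_star_mul_eq_zero φ.ext_nonneg (ext_star_mul_self_one_sub hφ hf) x
  rw [star_sub, star_one, ← inclusionHull_star, star_eq_of_urysohn hf, sub_mul, one_mul,
    map_sub] at this
  exact (sub_eq_zero.mp this).symm

/-- The Arens product makes the corner an iterated limit of `φ (g x f)` along two copies of the net,
and this expression is constant. -/
theorem corner_apply_of_mem_statesOn {K : Compacts T.Spectrum} {φ : State A}
    (hφ : φ ∈ T.statesOn K) (x : UnitalHull A) : T.corner K x φ.ext = φ.ext x := by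
  refine indicator_eq_of_forall fun g hg => ?_
  change indicator K ((dualMul φ.ext (T.inclusionHull g * x)).comp T.inclusionHull) = _
  refine indicator_eq_of_forall fun f hf => ?_
  change φ.ext (T.inclusionHull g * x * T.inclusionHull f) = _
  rw [ext_mul_urysohn hφ hf, ext_urysohn_mul hφ hg]

theorem norm_corner_apply_le (K : Compacts T.Spectrum) {f₀ : T.alg}
    (h₀ : f₀ ∈ urysohn (K : Set T.Spectrum)) (φ : State A) (x : UnitalHull A) :
    ‖T.corner K x φ.ext‖ ≤ ‖T.inclusionHull f₀ * x * T.inclusionHull f₀‖ := by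
  refine norm_indicator_le h₀ fun g hg => ?_
  change ‖indicator K ((dualMul φ.ext (T.inclusionHull (g * f₀) * x)).comp T.inclusionHull)‖ ≤ _
  refine norm_indicator_le h₀ fun f hf => ?_
  change ‖φ.ext (T.inclusionHull (g * f₀) * x * T.inclusionHull (f * f₀))‖ ≤ _
  rw [mul_comm f, inclusionHull_mul, inclusionHull_mul]
  refine (φ.norm_ext_apply_le _).trans ?_
  have e : T.inclusionHull g * T.inclusionHull f₀ * x * (T.inclusionHull f₀ * T.inclusionHull f) =
      T.inclusionHull g * (T.inclusionHull f₀ * x * T.inclusionHull f₀) * T.inclusionHull f := by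
    simp only [mul_assoc]
  rw [e]
  have hg1 := norm_le_one_of_urysohn hg
  have hf1 := norm_le_one_of_urysohn hf
  rw [← T.norm_inclusionHull] at hg1 hf1
  exact ((norm_mul_le _ _).trans (mul_le_of_le_one_right (norm_nonneg _) hf1)).trans
    ((norm_mul_le _ _).trans (mul_le_of_le_one_left (norm_nonneg _) hg1))

theorem corner_sub (K : Compacts T.Spectrum) (x y : UnitalHull A) (ω : StrongDual ℂ (UnitalHull A)) :
    T.corner K (x - y) ω = T.corner K x ω - T.corner K y ω := by
  change indicator K _ = indicator K _ - indicator K _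
  rw [← map_sub]
  congr 1
  ext g
  change bidualAct (T.indicatorHull K) ω (T.inclusionHull g * (x - y)) =
    bidualAct (T.indicatorHull K) ω (T.inclusionHull g * x) -
      bidualAct (T.indicatorHull K) ω (T.inclusionHull g * y)
  rw [mul_sub, map_sub]

/-- The state space itself need not be weak* closed, but the closed condition `φ f₀ = 1` with `‖f₀‖
≤ 1` prevents loss of norm in the limit. -/
theorem isCompact_statesOn (K : Compacts T.Spectrum) : IsCompact (T.statesOn K) := by
  refine State.isInducing_val.isCompact_iff.mpr ?_
  obtain ⟨f₀, h₀⟩ := urysohn_nonempty K.isCompact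
  refine (WeakDual.isCompact_closedBall (𝕜 := ℂ) (E := A) 0 1).of_isClosed_subset ?_ ?_
  · have : (fun φ : State A => (φ.1 : WeakDual ℂ A)) '' T.statesOn K =
        (WeakDual.toStrongDual ⁻¹' Metric.closedBall 0 1 ∩
          ⋂ a : A, {φ : WeakDual ℂ A | 0 ≤ φ (star a * a)}) ∩
        ⋂ f ∈ urysohn (K : Set T.Spectrum), {φ : WeakDual ℂ A | φ (f : A) = 1} := by
      ext φ
      simp only [Set.mem_image, Set.mem_ofPred_eq, Set.mem_inter_iff, Set.mem_iInter,
        Set.mem_preimage, mem_closedBall_zero_iff]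
      constructor
      · rintro ⟨χ, hχ, rfl⟩
        exact ⟨⟨χ.2.2.le, χ.2.1⟩, mem_statesOn_iff.mp hχ⟩
      · rintro ⟨⟨hn, hp⟩, hf⟩
        refine ⟨⟨φ, hp, le_antisymm hn ?_⟩, mem_statesOn_iff.mpr hf, rfl⟩
        have h1 := (WeakDual.toStrongDual φ).le_opNorm (f₀ : A)
        rw [show WeakDual.toStrongDual φ (f₀ : A) = 1 from hf f₀ h₀, norm_one] at h1
        exact h1.trans (mul_le_of_le_one_right (norm_nonneg _) (norm_le_one_of_urysohn h₀))
    rw [this]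
    refine ((WeakDual.isClosed_closedBall 0 1).inter (isClosed_iInter fun a => ?_)).inter
      (isClosed_biInter fun f _ => ?_)
    · exact isClosed_le continuous_const (WeakDual.eval_continuous _)
    · exact isClosed_eq (WeakDual.eval_continuous _) continuous_const
  · rintro _ ⟨φ, -, rfl⟩
    simp only [Set.mem_preimage, mem_closedBall_zero_iff]
    exact φ.2.2.le

/-! ### Compressions by compactly supported elements -/

/-- Compressing a state of `𝔲A` by a compactly supported element of the topography gives a multiple
of a state concentrated on the support. -/
theorem exists_state_compression {K : Compacts T.Spectrum} {f : T.alg} (hf : star f = f)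
    (hK : (Function.support fun χ : T.Spectrum => χ f) ⊆ K) {g : StrongDual ℂ (UnitalHull A)}
    (hg : ∀ a, 0 ≤ g (star a * a)) (h0 : g (T.inclusionHull (f * f)) ≠ 0) :
    ∃ φ ∈ T.statesOn K, ∀ x, g (T.inclusionHull f * x * T.inclusionHull f) =
      g (T.inclusionHull (f * f)) * φ.ext x := by
  set ι := T.inclusionHull with hι
  have hιf : star (ι f) = ι f := by rw [hι, ← inclusionHull_star, hf]
  have hιff : ι (f * f) = ι f * ι f := T.inclusionHull_mul f f
  let G : StrongDual ℂ (UnitalHull A) :=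
    g.comp ((ContinuousLinearMap.mul ℂ _).flip (ι f) ∘L ContinuousLinearMap.mul ℂ _ (ι f))
  have hG (x) : G x = g (ι f * x * ι f) := rfl
  have hGpos (x) : 0 ≤ G (star x * x) := by
    have := hg (x * ι f)
    rw [star_mul, hιf] at this
    rw [hG]
    simpa only [mul_assoc] using this
  have hG1 : G 1 = g (ι (f * f)) := by rw [hG, mul_one, hιff]
  set t := (G 1).re with ht
  have h1pos : 0 ≤ G 1 := by simpa using hGpos 1
  have hGt : G 1 = (t : ℂ) := Complex.ext rfl (by simpa using (Complex.nonneg_iff.mp h1pos).2.symm)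
  have htpos : 0 < t := by
    refine lt_of_le_of_ne (Complex.nonneg_iff.mp h1pos).1 fun h => h0 ?_
    rw [← hG1, hGt, ← h, Complex.ofReal_zero]
  have htc : (t : ℂ) ≠ 0 := by exact_mod_cast htpos.ne'
  let emb : A →L[ℂ] UnitalHull A :=
    ⟨{ toFun := UnitalHull.emb A, map_add' := map_add _, map_smul' := map_smul _ },
      (AddMonoidHomClass.isometry_of_norm _ UnitalHull.norm_emb).continuous⟩
  have hemb (a : A) : emb a = UnitalHull.emb A a := rfl
  let ρ : StrongDual ℂ (UnitalHull A) := (t : ℂ)⁻¹ • G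
  have hρ (x) : ρ x = (t : ℂ)⁻¹ * G x := rfl
  have hρpos (x) : 0 ≤ ρ (star x * x) := by
    rw [hρ]
    refine mul_nonneg ?_ (hGpos x)
    rw [← Complex.ofReal_inv]
    exact_mod_cast (inv_pos.mpr htpos).le
  have hρ1 : ρ 1 = 1 := by rw [hρ, hGt, inv_mul_cancel₀ htc]
  have hρle (x) : ‖ρ x‖ ≤ ‖x‖ := by
    have := norm_apply_le_of_positive hρpos x
    rwa [hρ1, Complex.one_re, one_mul] at this
  -- From `h f = f` one gets `g (f h f) = g (f f)`. This gives both the concentration on `K` and the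
  -- fact that the restriction of `ρ` to `A` still has norm one.
  have hρury (h : T.alg) (hh : h ∈ urysohn (K : Set T.Spectrum)) : ρ (ι h) = 1 := by
    rw [hρ, hG, mul_assoc, ← T.inclusionHull_mul, urysohn_mul_eq hh hK, ← hιff, ← hG1, hGt,
      inv_mul_cancel₀ htc]
  obtain ⟨f₀, h₀⟩ := urysohn_nonempty K.isCompact
  have hnorm : ‖ρ.comp emb‖ = 1 := by
    refine le_antisymm (ContinuousLinearMap.opNorm_le_bound _ zero_le_one fun a => ?_) ?_
    · rw [one_mul, ← UnitalHull.norm_emb a]; exact hρle _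
    · have h1 := (ρ.comp emb).le_opNorm (f₀ : A)
      rw [show ρ.comp emb (f₀ : A) = 1 from hρury f₀ h₀, norm_one] at h1
      exact h1.trans (mul_le_of_le_one_right (norm_nonneg _) (norm_le_one_of_urysohn h₀))
  let φ : State A := ⟨StrongDual.toWeakDual (ρ.comp emb), fun a => by
    have := hρpos (UnitalHull.emb A a)
    rwa [← map_star, ← map_mul] at this, hnorm⟩
  have hext : ρ = φ.ext := φ.ext_unique hρ1 fun a => rfl
  refine ⟨φ, mem_statesOn_iff.mpr fun h hh => hρury h hh, fun x => ?_⟩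
  rw [← hext, ← hG1, hGt, hρ, mul_inv_cancel_left₀ htc, hG]

theorem norm_compression_le {K : Compacts T.Spectrum} {f : T.alg} (hf : star f = f)
    (hf1 : ‖f‖ ≤ 1) (hK : (Function.support fun χ : T.Spectrum => χ f) ⊆ K) {x : UnitalHull A}
    (hx : IsSelfAdjoint x) {C : ℝ} (hC : 0 ≤ C) (h : ∀ φ ∈ T.statesOn K, ‖φ.ext x‖ ≤ C) :
    ‖T.inclusionHull f * x * T.inclusionHull f‖ ≤ C := by
  set ι := T.inclusionHull with hι
  have hιf : star (ι f) = ι f := by rw [hι, ← inclusionHull_star, hf]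
  by_cases hz : ι f * x * ι f = 0
  · rw [hz, norm_zero]; exact hC
  have hsa : IsSelfAdjoint (ι f * x * ι f) := by
    have := hx.conjugate (ι f)
    rwa [hιf] at this
  obtain ⟨g, hg1, hg, hgn⟩ := exists_norming_state hsa hz
  -- If it vanished, Cauchy–Schwarz would annihilate `f x f`, although `g` attains its nonzero norm.
  have h0 : g (ι (f * f)) ≠ 0 := by
    intro h0
    rw [T.inclusionHull_mul] at h0
    have := apply_mul_eq_zero hg (a := ι f) (by rw [hιf]; exact h0) (ι f * x)
    rw [this, norm_zero] at hgn
    exact hz (norm_eq_zero.mp hgn.symm)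
  obtain ⟨φ, hφ, hφx⟩ := exists_state_compression hf hK hg h0
  rw [← hgn, hφx, norm_mul]
  have hle : ‖g (ι (f * f))‖ ≤ 1 := by
    refine (norm_apply_le_of_positive hg _).trans ?_
    rw [hg1, Complex.one_re, one_mul, T.norm_inclusionHull]
    exact (norm_mul_le _ _).trans (mul_le_one₀ hf1 (norm_nonneg _) hf1)
  exact (mul_le_of_le_one_left (norm_nonneg _) hle).trans (h φ hφ)

theorem nontrivial_alg [Nontrivial A] : Nontrivial T.alg := by
  by_contra hM
  rw [not_nontrivial_iff_subsingleton] at hM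
  obtain ⟨l, hl, hmem⟩ := T.exists_approximateUnit
  have := hl.neBot
  obtain ⟨a, ha⟩ := exists_ne (0 : A)
  refine ha (tendsto_nhds_unique (hl.tendsto_mul_right a) ?_)
  refine tendsto_const_nhds.congr' ?_
  filter_upwards [hmem] with e he
  have : e = 0 := congrArg Subtype.val (Subsingleton.elim (⟨e, he⟩ : T.alg) 0)
  rw [this, zero_mul]

/-- Take a character of `M`, a compactly supported bump `f` equal to `1` there, and compress by `f`
a state norming `f * f`. -/
theorem localStates_nonempty [Nontrivial A] : T.localStates.Nonempty := by
  have := nontrivial_alg (T := T)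
  obtain ⟨y, hy⟩ := exists_ne (0 : T.alg)
  obtain ⟨χ, hχ⟩ : ∃ χ : T.Spectrum, χ y ≠ 0 := by
    by_contra! h
    exact hy (eq_of_forall_char fun χ => (h χ).trans (map_zero χ).symm)
  obtain ⟨f, hf, hfc⟩ := exists_urysohn_hasCompactSupport (isCompact_singleton (x := χ))
  have hff : f * f ≠ 0 := fun h => by
    have := congrArg χ h
    rw [map_mul, (hf χ).2 rfl, map_zero, one_mul] at this
    exact one_ne_zero this
  have hs := star_eq_of_urysohn hf
  have hn : T.inclusionHull (f * f) ≠ 0 := by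
    rwa [← norm_ne_zero_iff, T.norm_inclusionHull, norm_ne_zero_iff]
  have hsa : IsSelfAdjoint (T.inclusionHull (f * f)) := by
    rw [IsSelfAdjoint, ← inclusionHull_star, star_mul, hs]
  obtain ⟨g, -, hg, hgn⟩ := exists_norming_state hsa hn
  obtain ⟨φ, hφ, -⟩ := exists_state_compression (K := ⟨_, hfc⟩) hs (subset_tsupport _) hg
    (norm_ne_zero_iff.mp (hgn ▸ norm_ne_zero_iff.mpr hn))
  exact ⟨φ, Set.mem_iUnion.mpr ⟨_, hφ⟩⟩

end Topography

/-! ### The Monge-Kantorovich metric through `𝔏₁(A, L, μ)` -/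

theorem continuous_weakDual_of_forall_apply {X : Type u} [PseudoEMetricSpace X]
    {f : X → WeakDual ℂ A}
    (h : ∀ (a : A) (x : X) (ε : ℝ), 0 < ε →
      ∃ δ : ℝ≥0∞, 0 < δ ∧ ∀ y, edist y x < δ → ‖f y a - f x a‖ < ε) :
    Continuous f := by
  refine WeakDual.continuous_of_continuous_eval fun a => continuous_iff_continuousAt.mpr fun x =>
    Metric.tendsto_nhds.mpr fun ε hε => ?_
  obtain ⟨δ, hδ, hd⟩ := h a x ε hε
  filter_upwards [Metric.eball_mem_nhds x hδ] with y hy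
  rw [dist_eq_norm]
  exact hd y hy

namespace LipschitzPair
variable (P : LipschitzPair A)

theorem one_mem_dom (r : ℝ) : ∃ d : P.dom, P.L d = 0 ∧
    ((d : selfAdjoint (UnitalHull A)) : UnitalHull A) = (r : ℂ) • 1 := by
  have h : r • (1 : selfAdjoint (UnitalHull A)) ∈
      {a : selfAdjoint (UnitalHull A) | ∃ h : a ∈ P.dom, P.L ⟨a, h⟩ = 0} := by
    rw [P.ker_L]; exact ⟨r, rfl⟩
  obtain ⟨h1, h2⟩ := h
  refine ⟨⟨_, h1⟩, h2, ?_⟩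
  rw [Complex.coe_smul]
  rfl

variable {P}

theorem isSelfAdjoint_of_mem_lipBall {μ : State A} {x : UnitalHull A} (hx : x ∈ P.lipBall μ) :
    IsSelfAdjoint x := by
  obtain ⟨d, rfl, -⟩ := hx
  exact d.1.2

theorem exists_dom_sub {d : P.dom} (hd : P.L d ≤ 1) (r : ℝ) : ∃ d' : P.dom, P.L d' ≤ 1 ∧
    ((d' : selfAdjoint (UnitalHull A)) : UnitalHull A) = d - (r : ℂ) • 1 := by
  obtain ⟨e, he0, he⟩ := P.one_mem_dom r
  refine ⟨d - e, ?_, ?_⟩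
  · have := map_sub_le_add P.L d e
    rw [he0, add_zero] at this
    exact this.trans hd
  · rw [← he]; rfl

/-- Subtracting its value at `μ` from an element with `L ≤ 1` gives an element of
`𝔏₁(A, L, μ)`. -/
theorem sub_smul_mem_lipBall (μ : State A) {d : P.dom} (hd : P.L d ≤ 1) :
    ((d : selfAdjoint (UnitalHull A)) : UnitalHull A) -
      ((μ.ext ((d : selfAdjoint (UnitalHull A)) : UnitalHull A)).re : ℂ) • 1 ∈ P.lipBall μ := by
  obtain ⟨d', hd', he⟩ := exists_dom_sub hd
    (μ.ext ((d : selfAdjoint (UnitalHull A)) : UnitalHull A)).re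
  refine ⟨d', he, hd', ?_⟩
  rw [map_sub, map_smul, μ.ext_one, smul_eq_mul, mul_one, sub_eq_zero]
  exact Complex.ext rfl (by simpa using μ.im_ext_apply d.1.2)

/-- The metric only tests elements of `A`. A self-adjoint element of `𝔲A` is a self-adjoint element
of `A` plus a real scalar, and the scalar changes neither `L ≤ 1` nor differences of states. -/
theorem enorm_ext_sub_le {d : P.dom} (hd : P.L d ≤ 1) (φ ψ : State A) :
    ‖φ.ext ((d : selfAdjoint (UnitalHull A)) : UnitalHull A) -
        ψ.ext ((d : selfAdjoint (UnitalHull A)) : UnitalHull A)‖ₑ ≤ P.mongeKantorovich φ ψ := by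
  set x : UnitalHull A := ((d : selfAdjoint (UnitalHull A)) : UnitalHull A) with hx
  have hsa : star x = x := d.1.2
  obtain ⟨a, r, hxa⟩ := UnitalHull.exists_eq x
  have h2 : x = UnitalHull.emb A ((2⁻¹ : ℂ) • (a + star a)) + (r.re : ℂ) • 1 := by
    have hs := hsa
    rw [hxa, star_add, star_smul, star_one, ← map_star] at hs
    have hr : (r.re : ℂ) = 2⁻¹ * (r + star r) := by
      rw [Complex.re_eq_add_conj, div_eq_inv_mul]; rfl
    calc x = (2⁻¹ : ℂ) • (x + x) := by rw [← two_smul ℂ x, smul_smul]; norm_num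
      _ = (2⁻¹ : ℂ) • ((UnitalHull.emb A a + r • 1) + (UnitalHull.emb A (star a) + star r • 1)) := by
        rw [hs, ← hxa]
      _ = _ := by
        rw [map_smul, map_add, hr, mul_smul, add_smul, ← smul_add]
        congr 1
        abel
  obtain ⟨d', hd', he⟩ := exists_dom_sub hd r.re
  have hmem : (2⁻¹ : ℂ) • (a + star a) ∈ {a : A | IsSelfAdjoint a ∧
      ∃ d : P.dom, ((d : selfAdjoint (UnitalHull A)) : UnitalHull A) = UnitalHull.emb A a ∧
        P.L d ≤ 1} := by
    refine ⟨?_, d', ?_, hd'⟩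
    · rw [IsSelfAdjoint, star_smul, star_add, star_star, add_comm]
      simp
    · rw [he, ← hx, h2, add_sub_cancel_right]
  have hval (ρ : State A) : ρ.ext x = ρ.toDual ((2⁻¹ : ℂ) • (a + star a)) + r.re := by
    rw [h2, map_add, ρ.ext_emb, (ρ.ext).map_smul, ρ.ext_one, smul_eq_mul, mul_one]
  rw [hval, hval, add_sub_add_right_eq_sub]
  exact le_iSup₂_of_le (f := fun a _ => ‖φ.toDual a - ψ.toDual a‖ₑ) _ hmem le_rfl

theorem enorm_ext_sub_le_of_mem {μ : State A} {x : UnitalHull A} (hx : x ∈ P.lipBall μ)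
    (φ ψ : State A) : ‖φ.ext x - ψ.ext x‖ₑ ≤ P.mongeKantorovich φ ψ := by
  obtain ⟨d, rfl, hd, -⟩ := hx
  exact enorm_ext_sub_le hd φ ψ

theorem mongeKantorovich_le {μ φ ψ : State A} {C : ℝ≥0∞}
    (h : ∀ x ∈ P.lipBall μ, ‖φ.ext x - ψ.ext x‖ₑ ≤ C) : P.mongeKantorovich φ ψ ≤ C := by
  refine iSup₂_le fun a ha => ?_
  obtain ⟨-, d, hda, hd⟩ := ha
  have := h _ (sub_smul_mem_lipBall μ hd)
  simpa [hda, φ.ext_emb, ψ.ext_emb, φ.ext_one, ψ.ext_one] using this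

/-- Each evaluation is continuous for the Monge-Kantorovich metric. -/
theorem exists_dist_apply_lt (φ : State A) (a : A) {ε : ℝ} (hε : 0 < ε) :
    ∃ δ : ℝ, 0 < δ ∧ ∀ ψ : State A, P.mongeKantorovich ψ φ < ENNReal.ofReal δ →
      ‖ψ.toDual a - φ.toDual a‖ < ε := by
  have main (b : selfAdjoint (UnitalHull A)) (ε : ℝ) (hε : 0 < ε) :
      ∃ δ : ℝ, 0 < δ ∧ ∀ ψ : State A, P.mongeKantorovich ψ φ < ENNReal.ofReal δ →
        ‖ψ.ext (b : UnitalHull A) - φ.ext (b : UnitalHull A)‖ < ε := by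
    obtain ⟨d, hd, hbd⟩ := Metric.dense_iff.mp P.dense_dom b (ε / 3) (by positivity)
    have hbd' : ‖(b : UnitalHull A) - d‖ < ε / 3 := by
      rw [Metric.mem_ball, dist_comm, dist_eq_norm] at hd
      exact hd
    -- The summand `1` keeps `c` positive even when `L` vanishes at `d`.
    set c : ℝ := P.L ⟨d, hbd⟩ + 1 with hc
    have hcpos : 0 < c := by have := apply_nonneg P.L ⟨d, hbd⟩; linarith
    refine ⟨ε / 3 / c, by positivity, fun ψ hψ => ?_⟩
    have hL : P.L (c⁻¹ • ⟨d, hbd⟩) ≤ 1 := by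
      rw [map_smul_eq_mul, Real.norm_of_nonneg (by positivity), inv_mul_le_iff₀ hcpos]
      linarith
    have h1 := (enorm_ext_sub_le hL ψ φ).trans_lt hψ
    have hcoe : (((c⁻¹ • (⟨d, hbd⟩ : P.dom) : P.dom) : selfAdjoint (UnitalHull A)) : UnitalHull A) =
        ((c⁻¹ : ℝ) : ℂ) • (d : UnitalHull A) := by
      rw [Complex.coe_smul]; rfl
    rw [hcoe, map_smul, map_smul, ← smul_sub, ← ofReal_norm,
      ENNReal.ofReal_lt_ofReal_iff (by positivity), norm_smul, Complex.norm_real,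
      Real.norm_of_nonneg (by positivity), inv_mul_lt_iff₀ hcpos, mul_div_cancel₀ _ hcpos.ne'] at h1
    have h2 := ψ.norm_ext_apply_le ((b : UnitalHull A) - d)
    have h3 := φ.norm_ext_apply_le ((b : UnitalHull A) - d)
    calc ‖ψ.ext (b : UnitalHull A) - φ.ext (b : UnitalHull A)‖
        = ‖(ψ.ext ((b : UnitalHull A) - d) + (ψ.ext (d : UnitalHull A) - φ.ext (d : UnitalHull A)))
            - φ.ext ((b : UnitalHull A) - d)‖ := by
          rw [map_sub, map_sub]; congr 1; ring
      _ ≤ ‖ψ.ext ((b : UnitalHull A) - d)‖ + ‖ψ.ext (d : UnitalHull A) - φ.ext (d : UnitalHull A)‖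
          + ‖φ.ext ((b : UnitalHull A) - d)‖ :=
        (norm_sub_le _ _).trans (add_le_add_left (norm_add_le _ _) _)
      _ < ε := by linarith
  obtain ⟨δ₁, hδ₁, h₁⟩ := main (realPart (UnitalHull.emb A a)) (ε / 2) (by positivity)
  obtain ⟨δ₂, hδ₂, h₂⟩ := main (imaginaryPart (UnitalHull.emb A a)) (ε / 2) (by positivity)
  refine ⟨min δ₁ δ₂, lt_min hδ₁ hδ₂, fun ψ hψ => ?_⟩
  have k₁ := h₁ ψ (hψ.trans_le (ENNReal.ofReal_le_ofReal (min_le_left _ _)))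
  have k₂ := h₂ ψ (hψ.trans_le (ENNReal.ofReal_le_ofReal (min_le_right _ _)))
  rw [← ψ.ext_emb, ← φ.ext_emb, ← realPart_add_I_smul_imaginaryPart (UnitalHull.emb A a)]
  simp only [map_add, map_smul]
  rw [add_sub_add_comm, ← smul_sub]
  refine (norm_add_le _ _).trans_lt ?_
  rw [norm_smul, Complex.norm_I, one_mul]
  linarith

/-- If the weak* topology on `𝒦` is finer than that of the Monge-Kantorovich metric, the two
coincide. -/
theorem mkMetric_topology_induced_eq {𝒦 : Set (State A)}
    (h : ∀ φ ∈ 𝒦, ∀ ε : ℝ≥0∞, 0 < ε →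
      ∀ᶠ ψ in 𝓝 φ, ψ ∈ 𝒦 → P.mongeKantorovich ψ φ < ε) :
    P.mkMetric.toUniformSpace.toTopologicalSpace.induced ((↑) : 𝒦 → State A) =
      (inferInstance : TopologicalSpace 𝒦) := by
  apply le_antisymm
  · refine induced_mono ?_
    rw [State.isInducing_val.eq_induced]
    refine continuous_iff_le_induced.mp
      (@continuous_weakDual_of_forall_apply _ _ _ P.mkMetric _ fun a φ ε hε => ?_)
    obtain ⟨δ, hδ, hd⟩ := P.exists_dist_apply_lt φ a hε
    exact ⟨ENNReal.ofReal δ, ENNReal.ofReal_pos.mpr hδ, hd⟩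
  · refine le_of_nhds_le_nhds fun φ => ?_
    rw [@nhds_induced _ _ P.mkMetric.toUniformSpace.toTopologicalSpace]
    refine ((@Metric.nhds_basis_eball _ P.mkMetric φ.1).comap _).ge_iff.mpr fun ε hε => ?_
    have := h φ φ.2 ε hε
    exact mem_of_superset (continuous_subtype_val.tendsto φ this) fun ψ hψ => hψ ψ.2

end LipschitzPair

/-! ### Total boundedness -/

theorem totallyBounded_image_iff {X Y : Type*} [PseudoMetricSpace Y] {f : X → Y} {s : Set X} :
    TotallyBounded (f '' s) ↔
      ∀ ε > 0, ∃ t ⊆ s, t.Finite ∧ ∀ x ∈ s, ∃ y ∈ t, dist (f x) (f y) < ε := by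
  constructor
  · intro h ε hε
    obtain ⟨u, hu, hfin, hcov⟩ := Metric.finite_approx_of_totallyBounded h ε hε
    obtain ⟨t, ht, htfin, rfl⟩ := Set.exists_subset_image_finite_and.mp ⟨u, hu, hfin, rfl⟩
    refine ⟨t, ht, htfin, fun x hx => ?_⟩
    have := hcov (Set.mem_image_of_mem f hx)
    simpa using this
  · intro h
    refine Metric.totallyBounded_iff.mpr fun ε hε => ?_
    obtain ⟨t, -, htfin, ht⟩ := h ε hε
    refine ⟨f '' t, htfin.image f, ?_⟩
    rintro _ ⟨x, hx, rfl⟩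
    simpa using ht x hx

/-- A set that is compact for a topology which agrees on it with that of an extended metric has
finite nets for the metric. -/
theorem exists_finite_net {X : Type u} [TopologicalSpace X] (m : PseudoEMetricSpace X) {S : Set X}
    (h : m.toUniformSpace.toTopologicalSpace.induced ((↑) : S → X) =
      (inferInstance : TopologicalSpace S)) (hS : IsCompact S) {ε : ℝ≥0∞} (hε : 0 < ε) :
    ∃ t ⊆ S, t.Finite ∧ ∀ x ∈ S, ∃ y ∈ t, m.edist x y < ε := by
  have := isCompact_iff_compactSpace.mp hS
  have hU (y : S) : {x : S | m.edist x y < ε} ∈ 𝓝 y := by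
    have hm : {x : S | m.edist x y < ε} ∈
        @nhds S (m.toUniformSpace.toTopologicalSpace.induced ((↑) : S → X)) y := by
      rw [@nhds_induced _ _ m.toUniformSpace.toTopologicalSpace]
      exact preimage_mem_comap (@Metric.eball_mem_nhds _ m y.1 ε hε)
    rw [h] at hm
    exact hm
  obtain ⟨t, -, ht⟩ := isCompact_univ.elim_nhds_subcover (X := S) _ fun y _ => hU y
  refine ⟨(↑) '' (t : Set S), by simp, t.finite_toSet.image _, fun x hx => ?_⟩
  obtain ⟨y, hy, hxy⟩ := Set.mem_iUnion₂.mp (ht (Set.mem_univ ⟨x, hx⟩))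
  exact ⟨y, ⟨y, hy, rfl⟩, hxy⟩

theorem State.continuous_ext_apply (x : UnitalHull A) : Continuous fun φ : State A => φ.ext x := by
  obtain ⟨a, r, rfl⟩ := UnitalHull.exists_eq x
  have : Continuous fun φ : State A => φ.toDual a + r :=
    ((WeakDual.eval_continuous a).comp State.isInducing_val.continuous).add continuous_const
  refine this.congr fun φ => ?_
  rw [map_add, map_smul, φ.ext_emb, φ.ext_one, smul_eq_mul, mul_one]

/-! ### From totally bounded corners to the metric condition -/

namespace LipschitzTriple
variable (T : LipschitzTriple A)

/-- All the sets `a 𝔏₁(A, L, μ) b` with compactly supported `a`, `b` in the topography are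
totally bounded. -/
def HasTotallyBoundedCorners (μ : State A) : Prop :=
  ∀ a b : T.alg, T.IsCompactlySupported a → T.IsCompactlySupported b →
    TotallyBounded ((fun x => T.inclusionHull a * x * T.inclusionHull b) '' T.lipBall μ)

variable {T}

theorem HasTotallyBoundedCorners.exists_bound {μ : State A} (h : T.HasTotallyBoundedCorners μ)
    (K : Compacts T.Spectrum) :
    ∃ C : ℝ, ∀ φ ∈ T.statesOn K, ∀ x ∈ T.lipBall μ, ‖φ.ext x‖ ≤ C := by
  obtain ⟨f, hf, hfc⟩ := exists_urysohn_hasCompactSupport K.isCompact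
  obtain ⟨C, hC⟩ := (h f f hfc hfc).isBounded.exists_norm_le
  refine ⟨C, fun φ hφ x hx => ?_⟩
  rw [← Topography.ext_urysohn_mul hφ hf, ← Topography.ext_mul_urysohn hφ hf]
  exact (φ.norm_ext_apply_le _).trans (hC _ ⟨x, hx, rfl⟩)

/-- For `x` in the ball at `ν`, the element `x - μ(x)` lies in the ball at `μ`, and its value
`-μ(x)` at `ν` is bounded because `ν` is local. So the new set lies in the old one plus a compact
set of multiples of `ab`. -/
theorem HasTotallyBoundedCorners.of_mem_localStates {μ ν : State A}
    (h : T.HasTotallyBoundedCorners μ) (hν : ν ∈ T.localStates) :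
    T.HasTotallyBoundedCorners ν := by
  intro a b ha hb
  obtain ⟨K, hK⟩ := Set.mem_iUnion.mp hν
  obtain ⟨C, hC⟩ := h.exists_bound K
  have hcomp : IsCompact (closure
      ((fun x => T.inclusionHull a * x * T.inclusionHull b) '' T.lipBall μ)) :=
    (h a b ha hb).closure.isCompact_of_isClosed isClosed_closure
  have hcomp' : IsCompact ((fun z : ℂ => z • (T.inclusionHull a * T.inclusionHull b)) ''
      Metric.closedBall 0 C) :=
    (ProperSpace.isCompact_closedBall _ _).image (by fun_prop)
  refine (hcomp.add hcomp').totallyBounded.subset ?_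
  rintro _ ⟨_, ⟨d, rfl, hd, hd0⟩, rfl⟩
  have hmem := T.sub_smul_mem_lipBall μ hd
  set x : UnitalHull A := ((d : selfAdjoint (UnitalHull A)) : UnitalHull A) with hx
  have hval := hC ν hK _ hmem
  rw [map_sub, hd0, zero_sub, norm_neg, map_smul, ν.ext_one, smul_eq_mul, mul_one] at hval
  refine Set.mem_add.mpr ⟨_, subset_closure ⟨_, hmem, rfl⟩, _,
    ⟨((μ.ext x).re : ℂ), by simpa using hval, rfl⟩, ?_⟩
  simp only [mul_sub, sub_mul, mul_smul_comm, smul_mul_assoc, mul_one, sub_add_cancel]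

theorem HasTotallyBoundedCorners.isRegular {μ : State A} (h : T.HasTotallyBoundedCorners μ) :
    T.IsRegular := by
  intro K
  obtain ⟨C, hC⟩ := h.exists_bound K
  refine lt_of_le_of_lt (iSup₂_le fun φ hφ => iSup₂_le fun ψ hψ =>
    T.mongeKantorovich_le (μ := μ) (C := ENNReal.ofReal (C + C)) fun x hx => ?_)
    ENNReal.ofReal_lt_top
  rw [← ofReal_norm]
  exact ENNReal.ofReal_le_ofReal
    ((norm_sub_le _ _).trans (add_le_add (hC φ hφ x hx) (hC ψ hψ x hx)))

/-- On a tame set the weak* topology is finer than that of the Monge-Kantorovich metric. -/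
theorem HasTotallyBoundedCorners.eventually_mongeKantorovich_lt {μ : State A}
    (h : T.HasTotallyBoundedCorners μ) {𝒦 : Set (State A)}
    (h𝒦 : Tendsto (fun K : Compacts T.Spectrum =>
        ⨆ a ∈ T.lipBall μ, ⨆ φ ∈ 𝒦, ‖(toBidual a - T.corner K a) (State.ext φ)‖ₑ) atTop (𝓝 0))
    {φ : State A} (hφ : φ ∈ 𝒦) {ε : ℝ≥0∞} (hε : 0 < ε) :
    ∀ᶠ ψ in 𝓝 φ, ψ ∈ 𝒦 → T.mongeKantorovich ψ φ < ε := by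
  obtain ⟨e, he0, heε⟩ := ENNReal.lt_iff_exists_nnreal_btwn.mp hε
  have he : (0 : ℝ) < e := by exact_mod_cast he0
  -- The distance from `ψ x` to `φ x` splits as `3δ + δ + 3δ`: from `x` to a net element `b` at `ψ`,
  -- from `ψ` to `φ` at `b`, and back to `x` at `φ`.
  set δ : ℝ := e / 7 with hδ
  have hδ0 : 0 < δ := by positivity
  obtain ⟨K, hK⟩ := (h𝒦.eventually_lt_const (ENNReal.ofReal_pos.mpr hδ0)).exists
  have htame (ψ : State A) (hψ : ψ ∈ 𝒦) (x : UnitalHull A) (hx : x ∈ T.lipBall μ) :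
      ‖ψ.ext x - T.corner K x ψ.ext‖ < δ := by
    have h1 : ‖(toBidual x - T.corner K x) ψ.ext‖ₑ < ENNReal.ofReal δ :=
      (le_iSup₂_of_le (f := fun a _ => ⨆ φ ∈ 𝒦, ‖(toBidual a - T.corner K a) (State.ext φ)‖ₑ) x hx
        (le_iSup₂_of_le (f := fun φ _ => ‖(toBidual x - T.corner K x) (State.ext φ)‖ₑ)
          ψ hψ le_rfl)).trans_lt hK
    rw [← ofReal_norm, ENNReal.ofReal_lt_ofReal_iff hδ0] at h1
    exact h1
  obtain ⟨f, hf, hfc⟩ := exists_urysohn_hasCompactSupport K.isCompact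
  obtain ⟨F, hF, hFfin, hcov⟩ := totallyBounded_image_iff.mp (h f f hfc hfc) δ hδ0
  -- Passing to the corners of `x` and `b` costs `δ` each by tameness; the corner of `x - b` is
  -- bounded by `‖f (x - b) f‖ < δ`.
  have hnear (ψ : State A) (hψ : ψ ∈ 𝒦) {x b : UnitalHull A} (hx : x ∈ T.lipBall μ)
      (hb : b ∈ T.lipBall μ)
      (hxb : dist (T.inclusionHull f * x * T.inclusionHull f)
        (T.inclusionHull f * b * T.inclusionHull f) < δ) : ‖ψ.ext x - ψ.ext b‖ < 3 * δ := by
    have h1 := htame ψ hψ x hx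
    have h2 := htame ψ hψ b hb
    have h3 := T.norm_corner_apply_le K hf ψ (x - b)
    rw [Topography.corner_sub, mul_sub, sub_mul, ← dist_eq_norm] at h3
    rw [← dist_eq_norm] at h1 h2 ⊢
    rw [← dist_eq_norm (T.inclusionHull f * x * T.inclusionHull f)] at h3
    have h4 := dist_triangle4 (ψ.ext x) (T.corner K x ψ.ext) (T.corner K b ψ.ext) (ψ.ext b)
    rw [dist_comm (T.corner K b ψ.ext)] at h4
    linarith
  have hev : ∀ᶠ ψ in 𝓝 φ, ∀ b ∈ F, dist (State.ext ψ b) (φ.ext b) < δ :=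
    (eventually_all_finite hFfin).mpr fun b _ =>
      Metric.tendsto_nhds.mp ((State.continuous_ext_apply b).tendsto φ) δ hδ0
  filter_upwards [hev] with ψ hψ hψ𝒦
  refine lt_of_le_of_lt (T.mongeKantorovich_le (μ := μ) fun x hx => ?_) heε
  obtain ⟨b, hb, hxb⟩ := hcov x hx
  have h1 := hnear ψ hψ𝒦 hx (hF hb) hxb
  have h2 := hnear φ hφ hx (hF hb) hxb
  have h3 := hψ b hb
  rw [← dist_eq_norm] at h1 h2
  have h4 := dist_triangle4 (ψ.ext x) (ψ.ext b) (φ.ext b) (φ.ext x)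
  rw [dist_comm (φ.ext b)] at h4
  rw [← ofReal_norm, ← dist_eq_norm, ← ENNReal.ofReal_coe_nnreal]
  refine ENNReal.ofReal_le_ofReal ?_
  have : (e : ℝ) = 7 * δ := by rw [hδ]; ring
  linarith

theorem isQuantumLocallyCompactMetricSpace_of_hasTotallyBoundedCorners {μ : State A}
    (h : T.HasTotallyBoundedCorners μ) : T.IsQuantumLocallyCompactMetricSpace := by
  refine ⟨h.isRegular, fun 𝒦 ⟨ν, hν, h𝒦⟩ => ?_⟩
  exact T.mkMetric_topology_induced_eq fun φ hφ ε hε =>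
    (h.of_mem_localStates hν).eventually_mongeKantorovich_lt h𝒦 hφ hε

/-! ### From the metric condition to totally bounded corners -/

theorem isTame_statesOn {μ : State A} (hμ : μ ∈ T.localStates) (K : Compacts T.Spectrum) :
    T.IsTame (T.statesOn K) := by
  refine ⟨μ, hμ, tendsto_const_nhds.congr' ?_⟩
  filter_upwards [eventually_ge_atTop K] with K' hK'
  refine (bot_unique (iSup₂_le fun x _ => iSup₂_le fun φ hφ => ?_)).symm
  change ‖φ.ext x - T.corner K' x φ.ext‖ₑ ≤ 0
  rw [Topography.corner_apply_of_mem_statesOn (Topography.statesOn_mono hK' hφ), sub_self,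
    enorm_zero]

/-- Elements of the ball vanish at `μ`, so their values on `𝒮(A|K)` are differences with the value
at `μ`, bounded by the diameter. -/
theorem IsRegular.exists_bound (h : T.IsRegular) {K : Compacts T.Spectrum} {μ : State A}
    (hμ : μ ∈ T.statesOn K) :
    ∃ C : ℝ, ∀ φ ∈ T.statesOn K, ∀ x ∈ T.lipBall μ, ‖φ.ext x‖ ≤ C := by
  refine ⟨(⨆ φ ∈ T.statesOn K, ⨆ ψ ∈ T.statesOn K, T.mongeKantorovich φ ψ).toReal,
    fun φ hφ x hx => ?_⟩
  have h1 : ‖φ.ext x - μ.ext x‖ₑ ≤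
      ⨆ φ ∈ T.statesOn K, ⨆ ψ ∈ T.statesOn K, T.mongeKantorovich φ ψ :=
    (T.enorm_ext_sub_le_of_mem hx φ μ).trans
      (le_iSup₂_of_le (f := fun φ _ => ⨆ ψ ∈ T.statesOn K, T.mongeKantorovich φ ψ) φ hφ
        (le_iSup₂_of_le (f := fun ψ _ => T.mongeKantorovich φ ψ) μ hμ le_rfl))
  have h0 : μ.ext x = 0 := by
    obtain ⟨d, -, -, h0⟩ := hx
    exact h0
  rw [h0, sub_zero, ← ofReal_norm] at h1
  exact (ENNReal.ofReal_le_iff_le_toReal (h K).ne).mp h1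

theorem IsQuantumLocallyCompactMetricSpace.totallyBounded_compression
    (h : T.IsQuantumLocallyCompactMetricSpace) {μ : State A} (hμ : μ ∈ T.localStates) {f : T.alg}
    (hf : star f = f) (hf1 : ‖f‖ ≤ 1) (hfc : T.IsCompactlySupported f) :
    TotallyBounded ((fun x => T.inclusionHull f * x * T.inclusionHull f) '' T.lipBall μ) := by
  obtain ⟨K₀, hK₀⟩ := Set.mem_iUnion.mp hμ
  -- `K` must carry `μ`, for the bound `C`, and contain the support of `f`, for the compression
  -- estimate.
  let K : Compacts T.Spectrum := K₀ ⊔ ⟨_, hfc⟩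
  have hμK : μ ∈ T.statesOn K := Topography.statesOn_mono le_sup_left hK₀
  have hsupp : (Function.support fun χ : T.Spectrum => χ f) ⊆ K :=
    (subset_tsupport _).trans Set.subset_union_right
  obtain ⟨C, hC⟩ := h.1.exists_bound hμK
  have hC0 : 0 ≤ C ∨ T.lipBall μ = ∅ := by
    rcases (T.lipBall μ).eq_empty_or_nonempty with hE | ⟨x, hx⟩
    · exact .inr hE
    · exact .inl ((norm_nonneg _).trans (hC μ hμK x hx))
  rcases hC0 with hC0 | hE
  swap
  · rw [hE, Set.image_empty]; exact totallyBounded_empty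
  refine totallyBounded_image_iff.mpr fun ε hε => ?_
  set δ := ε / 4 with hδ
  have hδ0 : 0 < δ := by positivity
  obtain ⟨t, htK, htfin, ht⟩ := exists_finite_net T.mkMetric (h.2 _ (isTame_statesOn hμ K))
    (Topography.isCompact_statesOn K) (ENNReal.ofReal_pos.mpr hδ0)
  have := htfin.fintype
  -- A finite metric net `t` of states turns the ball into a bounded subset of `ℂ^t`; nearness there
  -- is nearness on all of `𝒮(A|K)` up to `2δ`.
  have htb : TotallyBounded ((fun (x : UnitalHull A) (φ : t) => φ.1.ext x) '' T.lipBall μ) := by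
    refine (ProperSpace.isCompact_closedBall (0 : t → ℂ) C).totallyBounded.subset ?_
    rintro _ ⟨x, hx, rfl⟩
    rw [mem_closedBall_zero_iff, pi_norm_le_iff_of_nonneg hC0]
    exact fun φ => hC φ (htK φ.2) x hx
  obtain ⟨F, hF, hFfin, hcov⟩ := totallyBounded_image_iff.mp htb δ hδ0
  refine ⟨F, hF, hFfin, fun x hx => ?_⟩
  obtain ⟨b, hb, hxb⟩ := hcov x hx
  refine ⟨b, hb, ?_⟩
  rw [dist_eq_norm, ← sub_mul, ← mul_sub]
  have hsa : IsSelfAdjoint (x - b) :=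
    (T.isSelfAdjoint_of_mem_lipBall hx).sub (T.isSelfAdjoint_of_mem_lipBall (hF hb))
  refine lt_of_le_of_lt (Topography.norm_compression_le hf hf1 hsupp hsa (C := 3 * δ)
    (by positivity) fun φ hφ => ?_) (by rw [hδ]; linarith)
  obtain ⟨ψ, hψ, hφψ⟩ := ht φ hφ
  have key (y : UnitalHull A) (hy : y ∈ T.lipBall μ) : dist (φ.ext y) (ψ.ext y) < δ := by
    have h1 := (T.enorm_ext_sub_le_of_mem hy φ ψ).trans_lt hφψ
    rwa [← ofReal_norm, ENNReal.ofReal_lt_ofReal_iff hδ0, ← dist_eq_norm] at h1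
  have h1 := key x hx
  have h2 := key b (hF hb)
  have h3 : dist (ψ.ext x) (ψ.ext b) < δ := (dist_pi_lt_iff hδ0).mp hxb ⟨ψ, hψ⟩
  have h4 := dist_triangle4 (φ.ext x) (ψ.ext x) (ψ.ext b) (φ.ext b)
  rw [dist_comm (ψ.ext b)] at h4
  rw [map_sub, ← dist_eq_norm]
  linarith

theorem IsQuantumLocallyCompactMetricSpace.hasTotallyBoundedCorners
    (h : T.IsQuantumLocallyCompactMetricSpace) {μ : State A} (hμ : μ ∈ T.localStates) :
    T.HasTotallyBoundedCorners μ := by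
  intro a b ha hb
  obtain ⟨f, hf, hfc⟩ := exists_urysohn_hasCompactSupport (M := T.alg)
    (IsCompact.union (HasCompactSupport.isCompact ha) (HasCompactSupport.isCompact hb))
  have htb := h.totallyBounded_compression hμ (star_eq_of_urysohn hf) (norm_le_one_of_urysohn hf)
    hfc
  let Φ : UnitalHull A →L[ℂ] UnitalHull A :=
    (ContinuousLinearMap.mul ℂ _).flip (T.inclusionHull b) ∘L
      ContinuousLinearMap.mul ℂ _ (T.inclusionHull a)
  refine (htb.image Φ.uniformContinuous).subset ?_
  rintro _ ⟨x, hx, rfl⟩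
  refine ⟨_, ⟨x, hx, rfl⟩, ?_⟩
  have hfa : f * a = a := urysohn_mul_eq hf ((subset_tsupport _).trans Set.subset_union_left)
  have hfb : f * b = b := urysohn_mul_eq hf ((subset_tsupport _).trans Set.subset_union_right)
  change T.inclusionHull a * (T.inclusionHull f * x * T.inclusionHull f) * T.inclusionHull b =
    T.inclusionHull a * x * T.inclusionHull b
  rw [← mul_assoc, ← mul_assoc, ← T.inclusionHull_mul, mul_assoc _ (T.inclusionHull f),
    ← T.inclusionHull_mul, hfb, mul_comm a f, hfa]

end LipschitzTriple

end QLCMS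
end

theorem mainTheorem2 {A : Type*} [NonUnitalCStarAlgebra A] [Nontrivial A]
    (T : QLCMS.LipschitzTriple A) :
    List.TFAE [
      T.IsQuantumLocallyCompactMetricSpace,
      ∀ μ ∈ T.localStates, ∀ a b : T.alg, T.IsCompactlySupported a → T.IsCompactlySupported b →
        TotallyBounded ((fun x => T.inclusionHull a * x * T.inclusionHull b) '' T.lipBall μ),
      ∃ μ ∈ T.localStates, ∀ a b : T.alg, T.IsCompactlySupported a → T.IsCompactlySupported b →
        TotallyBounded ((fun x => T.inclusionHull a * x * T.inclusionHull b) '' T.lipBall μ)] := by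
  tfae_have 1 → 2 := fun h μ hμ => h.hasTotallyBoundedCorners hμ
  tfae_have 2 → 3 := fun h =>
    have ⟨μ, hμ⟩ := QLCMS.Topography.localStates_nonempty (T := T.toTopography)
    ⟨μ, hμ, h μ hμ⟩
  tfae_have 3 → 1 := fun ⟨_, _, h⟩ =>
    QLCMS.LipschitzTriple.isQuantumLocallyCompactMetricSpace_of_hasTotallyBoundedCorners h
  tfae_finish
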